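/- Let $n,k,m$ be integers with $n\ge 1$ and $1\le k\le m$. For $z,w\in\mathbb C^m$ let $$\Pi(z,w)=\pi^{-m}\exp\!\big(i\,\mathrm{Im}(z\cdot\bar w)-\tfrac12|z-w|^2\big)$$ (the level one Szegő kernel of the reduced Heisenberg group, at zero angles). For a configuration $z=(z^1,\dots,z^n)$ of distinct points of $\mathbb C^m$, define the matrices, with $p,p'\in\{1,\dots,n\}$ and $q,q'\in\{1,\dots,m\}$, $$A^p_{p'}=\Pi(z^p,z^{p'}),\qquad B^p_{p'q'}=(z^p_{q'}-z^{p'}_{q'})\,\Pi(z^p,z^{p'}),\qquad C^{pq}_{p'q'}=\big(\delta_{qq'}+(\bar z^{p'}_q-\bar z^p_q)(z^p_{q'}-z^{p'}_{q'})\big)\Pi(z^p,z^{p'}),$$ and $\Lambda=C-B^*A^{-1}B$. The $n$-point scaling limit zero correlation function (for the common zeros of $k$ independent Gaussian random sections in complex dimension $m$) is $$K^\infty_{nkm}(z^1,\dots,z^n)=\frac1{[\pi^n\det A]^k}\int_{\mathbb C^{kmn}}\prod_{p=1}^n\det_{1\le j,j'\le k}\Big(\sum_{q=1}^m\xi^p_{jq}\,\bar\xi^p_{j'q}\Big)\,d\gamma_{I_k\otimes\Lambda}(\xi),$$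 where $\gamma_S$ denotes the centred complex Gaussian measure with $\mathbf E\,\xi_a\bar\xi_b=S_{ab}$, $\mathbf E\,\xi_a\xi_b=0$. Its normalization is $\widetilde K^\infty_{nkm}=\big(\pi^k(m-k)!/m!\big)^n K^\infty_{nkm}$, and the connected (truncated) correlation function is $$\widetilde T^\infty_{nkm}(z^1,\dots,z^n)=\sum_G(-1)^{l+1}(l-1)!\prod_{j=1}^l\widetilde K^\infty_{n_jkm}(z^{p_{j1}},\dots,z^{p_{jn_j}}),$$ the sum being over all partitions $G=(G_1,\dots,G_l)$ of $\{1,\dots,n\}$, with $G_j=\{p_{j1},\dots,p_{jn_j}\}$. Let $$d(z^1,\dots,z^n)=\max_{\mathcal G}\prod_{l\in L}|z^{i(l)}-z^{f(l)}|^2e^{-|z^{i(l)}-z^{f(l)}|^2/2},$$ where the maximum is over all finite connected oriented graphs $\mathcal G=(V,L)$ with vertex set $V=\{z^1,\dots,z^n\}$ (multiple edges allowed) that have zero boundary, i.e. at each vertex the number of edges beginning there equals the number of edges ending there; $i(l)$ and $f(l)$ are the initial and final vertices of the edge $l$. (For $n=1$ the graph without edges is admitted, so that $d=1$.) **Theorem.**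 For every $c>0$ there is a constant $C$, depending only on $n,k,m,c$, such that $$|\widetilde T^\infty_{nkm}(z^1,\dots,z^n)|\le C\,d(z^1,\dots,z^n)$$ for all $z^1,\dots,z^n\in\mathbb C^m$ with $\min_{p\ne q}|z^p-z^q|\ge c$. -/

import Mathlib

noncomputable section

namespace ZeroCorrelation

open MeasureTheory ProbabilityTheory
open scoped ComplexConjugate Kronecker MatrixOrder

/-! ### Complex Gaussian measures -/

/-- The standard complex Gaussian measure on `ℂ`: the real and imaginary parts are independent
centred real Gaussians of variance `1/2`, so that `E x = 0`, `E x² = 0` and `E |x|² = 1`. -/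
def stdComplexGaussian : Measure ℂ :=
  ((gaussianReal 0 (1 / 2)).prod (gaussianReal 0 (1 / 2))).map Complex.measurableEquivRealProd.symm

/-- The (generalized) centred complex Gaussian measure `γ_S` on `ℂ^ι` with positive semi-definite
covariance matrix `S`, i.e. `E (ξ_a conj ξ_b) = S a b` and `E (ξ_a ξ_b) = 0`. It is the law of
`S^{1/2} g`, where the coordinates of `g` are i.i.d. standard complex Gaussians. -/
def complexGaussian {ι : Type*} [Fintype ι] [DecidableEq ι] (S : Matrix ι ι ℂ) :
    Measure (ι → ℂ) :=
  (Measure.pi fun _ : ι => stdComplexGaussian).map fun g => (CFC.sqrt S).mulVec g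

/-! ### The scaling limit zero correlation functions

A configuration of `n` points of `ℂ^m` is a map `z : V → ℂ^m` on a finite set `V` of `n` labels. -/

section Correlation

variable {V : Type*} [Fintype V] [DecidableEq V] {m : ℕ}

/-- The level one Szegő kernel of the reduced Heisenberg group at `((z, 0), (w, 0))`:
`π^{-m} exp (i Im (z · conj w) - |z - w|² / 2)`. -/
def szegoKernel (z w : EuclideanSpace ℂ (Fin m)) : ℂ :=
  1 / (Real.pi : ℂ) ^ m *
    Complex.exp (Complex.I * ((∑ q, z q * conj (w q)).im : ℂ) - ((‖z - w‖ ^ 2 / 2 : ℝ) : ℂ))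

/-- The covariance matrix `A^∞` of the values at the points `z^p`. -/
def matA (z : V → EuclideanSpace ℂ (Fin m)) : Matrix V V ℂ :=
  Matrix.of fun p p' => szegoKernel (z p) (z p')

/-- The covariance matrix `B^∞` of the values with the holomorphic derivatives. -/
def matB (z : V → EuclideanSpace ℂ (Fin m)) : Matrix V (V × Fin m) ℂ :=
  Matrix.of fun p b => (z p b.2 - z b.1 b.2) * szegoKernel (z p) (z b.1)

/-- The covariance matrix `C^∞` of the holomorphic derivatives. -/
def matC (z : V → EuclideanSpace ℂ (Fin m)) : Matrix (V × Fin m) (V × Fin m) ℂ :=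
  Matrix.of fun a b =>
    ((if a.2 = b.2 then 1 else 0) +
      (conj (z b.1 a.2) - conj (z a.1 a.2)) * (z a.1 b.2 - z b.1 b.2)) *
      szegoKernel (z a.1) (z b.1)

/-- `Λ^∞ = C^∞ - (B^∞)^* (A^∞)^{-1} B^∞`, the covariance matrix of the derivatives conditioned on
the vanishing of the values. -/
def matLambda (z : V → EuclideanSpace ℂ (Fin m)) : Matrix (V × Fin m) (V × Fin m) ℂ :=
  matC z - (matB z).conjTranspose * (matA z)⁻¹ * matB z

/-- The `n`-point scaling limit zero correlation function `K^∞_{nkm}` (`n = #V`) of the simultaneous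
zeros of `k` independent sections in dimension `m`:
`(π^n det A^∞)^{-k} ∫ ∏_p det_{j,j'} (∑_q ξ^p_{jq} conj ξ^p_{j'q}) dγ_{I_k ⊗ Λ^∞} (ξ)`. -/
def limitCorrelation (k : ℕ) (z : V → EuclideanSpace ℂ (Fin m)) : ℂ :=
  1 / ((Real.pi : ℂ) ^ Fintype.card V * (matA z).det) ^ k *
    ∫ ξ : Fin k × V × Fin m → ℂ,
      ∏ p : V, (Matrix.of fun j j' : Fin k => ∑ q, ξ (j, p, q) * conj (ξ (j', p, q))).det
      ∂(complexGaussian ((1 : Matrix (Fin k) (Fin k) ℂ) ⊗ₖ matLambda z))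

/-- The one-point function `K^∞_{1km} = m! / (π^k (m - k)!)` (for `k ≤ m`), the expected density
of the zero set. -/
def zeroDensity (k m : ℕ) : ℝ :=
  (m.factorial : ℝ) / (Real.pi ^ k * ((m - k).factorial : ℝ))

/-- The normalized `n`-point scaling limit zero correlation function
`(K^∞_{1km})^{-n} K^∞_{nkm}`. -/
def normalizedCorrelation (k : ℕ) (z : V → EuclideanSpace ℂ (Fin m)) : ℂ :=
  ((zeroDensity k m : ℂ) ^ Fintype.card V)⁻¹ * limitCorrelation k z

/-- The connected (truncated) `n`-point function: the sum over all partitions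
`G = {G_1, …, G_l}` of the label set of `(-1)^{l+1} (l-1)! ∏_j` (normalized correlation function
of the points with labels in `G_j`). -/
def connectedCorrelation (k : ℕ) (z : V → EuclideanSpace ℂ (Fin m)) : ℂ :=
  ∑ G : Finpartition (Finset.univ : Finset V),
    (-1) ^ (G.parts.card + 1) * ((G.parts.card - 1).factorial : ℂ) *
      ∏ B ∈ G.parts, normalizedCorrelation k fun p : B => z p

end Correlation

/-! ### Oriented graphs with zero boundary -/

section Graph

variable {V : Type*} [Fintype V] {m : ℕ}

/-- A finite oriented graph on the vertex set `V`, with multiple edges allowed, is given by the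
number `L p q` of edges from `p` to `q`. It has zero boundary if at each vertex the number of
edges beginning there equals the number of edges ending there. -/
def ZeroBoundary (L : V → V → ℕ) : Prop :=
  ∀ p, ∑ q, L p q = ∑ q, L q p

/-- Any two vertices are joined by a chain of edges, irrespective of the orientation. -/
def GraphConnected (L : V → V → ℕ) : Prop :=
  ∀ p q, Relation.ReflTransGen (fun a b => 0 < L a b ∨ 0 < L b a) p q

/-- The product over the edges of `|z^i - z^f|² exp (-|z^i - z^f|² / 2)`, with multiplicity. -/
def graphWeight (z : V → EuclideanSpace ℂ (Fin m)) (L : V → V → ℕ) : ℝ :=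
  ∏ p, ∏ q, (‖z p - z q‖ ^ 2 * Real.exp (-‖z p - z q‖ ^ 2 / 2)) ^ L p q

/-- The weights of all connected oriented graphs with zero boundary on the points `z`. -/
def graphWeights (z : V → EuclideanSpace ℂ (Fin m)) : Set ℝ :=
  {w | ∃ L : V → V → ℕ, GraphConnected L ∧ ZeroBoundary L ∧ w = graphWeight z L}

/-- The maximal weight of a connected oriented graph with zero boundary on the points `z`;
the supremum is attained, see `isGreatest_graphDecay`. -/
def graphDecay (z : V → EuclideanSpace ℂ (Fin m)) : ℝ :=
  sSup (graphWeights z)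

lemma edgeWeight_le_one (r : ℝ) : r ^ 2 * Real.exp (-r ^ 2 / 2) ≤ 1 := by
  have h := Real.add_one_le_exp (r ^ 2 / 2 - 1)
  have h1 : Real.exp (r ^ 2 / 2 - 1) * Real.exp (-r ^ 2 / 2) = Real.exp (-1) := by
    rw [← Real.exp_add]; ring_nf
  have h2 : Real.exp (-1) ≤ 1 / 2 := by
    rw [Real.exp_neg, one_div]
    exact inv_anti₀ (by norm_num) (by linarith [Real.add_one_le_exp (1 : ℝ)])
  nlinarith [Real.exp_pos (-r ^ 2 / 2)]

lemma graphWeight_anti (z : V → EuclideanSpace ℂ (Fin m)) : Antitone (graphWeight z) := by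
  intro L L' h
  have h0 : ∀ p q, 0 ≤ ‖z p - z q‖ ^ 2 * Real.exp (-‖z p - z q‖ ^ 2 / 2) := fun p q => by positivity
  exact Finset.prod_le_prod (fun p _ => Finset.prod_nonneg fun q _ => pow_nonneg (h0 p q) _)
    fun p _ => Finset.prod_le_prod (fun q _ => pow_nonneg (h0 p q) _)
      fun q _ => pow_le_pow_of_le_one (h0 p q) (edgeWeight_le_one _) (h p q)

/-- The supremum in the definition of `graphDecay` is a maximum. -/
lemma isGreatest_graphDecay (z : V → EuclideanSpace ℂ (Fin m)) :
    IsGreatest (graphWeights z) (graphDecay z) := by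
  set S : Set (V → V → ℕ) := {L | GraphConnected L ∧ ZeroBoundary L}
  have hne : S.Nonempty := ⟨fun _ _ => 1, fun p q => .single (by simp), fun p => rfl⟩
  have hfin : {L | Minimal (· ∈ S) L}.Finite :=
    (setOfPred_minimal_antichain _).finite_of_partiallyWellOrderedOn
      (Set.isPWO_of_wellQuasiOrderedLE _)
  have hmin : ∀ L ∈ S, ∃ M, M ≤ L ∧ Minimal (· ∈ S) M := fun L hL =>
    exists_minimal_le_of_wellFoundedLT _ L hL
  obtain ⟨L₀, hL₀⟩ := hne
  obtain ⟨M₀, -, hM₀⟩ := hmin L₀ hL₀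
  obtain ⟨M, hM, hmax⟩ := Set.exists_max_image _ (graphWeight z) hfin ⟨M₀, hM₀⟩
  have hg : IsGreatest (graphWeights z) (graphWeight z M) := by
    refine ⟨⟨M, hM.prop.1, hM.prop.2, rfl⟩, ?_⟩
    rintro w ⟨L, h1, h2, rfl⟩
    obtain ⟨M', hle, hM'⟩ := hmin L ⟨h1, h2⟩
    exact (graphWeight_anti z hle).trans (hmax M' hM')
  rw [graphDecay, hg.csSup_eq]
  exact hg

end Graph

end ZeroCorrelation

end

/-! The values and covariant derivatives of a Gaussian section at the points have a joint covariance
matrix whose blocks are A, B and C. By Wick's formula the integral defining the correlation function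
is a polynomial in the entries of Λ (`integral_prod_det`), so the correlation function is a rational
function of the joint covariance whose denominator is a power of det A. Clearing denominators over
all subsets of the points turns the connected function into one polynomial Q, with constant
coefficients, in the entries between distinct points (`connectedNum`, `map_connectedNum`). A
variable of Q joins two points, so each monomial is an oriented multigraph.

Two structural facts determine which graphs occur. Rescaling the data at the point p by t_p and the
conjugate data by 1/t_p leaves Q unchanged, so in each monomial every vertex has equal in- and
out-degree (`isWeightedHomogeneous_connectedNum`, `zeroBoundary_monomialGraph`). If the points split
into two uncorrelated groups, correlation functions factor and, by the cumulant property, the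
connected function vanishes. Hence Q vanishes once the variables between the groups are set to zero
(`sum_finpartition_eq_zero`, `killVars_connectedNum`), and no monomial has a disconnected graph.

For points at mutual distance at least c each entry is at most a constant times the weight of its
edge (`norm_jointMatrix_le`), so |Q| is bounded by a multiple of `graphDecay`
(`exists_bound_of_gaugeInvariant`). It remains to divide by the determinants, which needs a lower
bound for det A uniform over separated configurations. This comes from an interpolation argument for
the kernel exp⟨w, z⟩ (`gramBound_mul_le`). -/

namespace ZeroCorrelation

/-! ### Cumulants of multiplicative set functions, by counting colorings -/

section Cumulants

open Polynomial

variable {V : Type*} [Fintype V] [DecidableEq V] {R : Type*}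

/-- The coloring of a set obtained from a partition by giving distinct colors to the parts. -/
def partitionColoring {N : ℕ}
    (x : Σ G : Finpartition (Finset.univ : Finset V), (G.parts ↪ Fin N)) : V → Fin N :=
  fun p => x.2 ⟨x.1.part p, x.1.part_mem.2 (Finset.mem_univ p)⟩

lemma partitionColoring_eq_iff {N : ℕ}
    (x : Σ G : Finpartition (Finset.univ : Finset V), (G.parts ↪ Fin N)) (p q : V) :
    partitionColoring x p = partitionColoring x q ↔ x.1.part p = x.1.part q := by
  simp [partitionColoring]

/-- A coloring amounts to its partition into color classes together with an injective choice of a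
color for each nonempty class. -/
lemma partitionColoring_bijective (N : ℕ) :
    Function.Bijective (partitionColoring (V := V) (N := N)) := by
  constructor
  · rintro ⟨G, e⟩ ⟨G', e'⟩ h
    have hpart : ∀ p, G.part p = G'.part p := fun p => by
      ext q
      rw [G.mem_part_iff_part_eq_part (Finset.mem_univ _) (Finset.mem_univ _),
        G'.mem_part_iff_part_eq_part (Finset.mem_univ _) (Finset.mem_univ _),
        ← partitionColoring_eq_iff ⟨G, e⟩, ← partitionColoring_eq_iff ⟨G', e'⟩, h]
    have hsub : ∀ (G G' : Finpartition (Finset.univ : Finset V)),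
        (∀ p, G.part p = G'.part p) → G.parts ⊆ G'.parts := fun G G' hp B hB => by
      obtain ⟨a, ha⟩ := G.nonempty_of_mem_parts hB
      rw [← G.part_eq_of_mem hB ha, hp]
      exact G'.part_mem.2 (Finset.mem_univ a)
    obtain rfl : G = G' := Finpartition.ext
      ((hsub G G' hpart).antisymm (hsub G' G fun p => (hpart p).symm))
    congr 1
    ext ⟨B, hB⟩
    obtain ⟨a, ha⟩ := G.nonempty_of_mem_parts hB
    have := congrFun h a
    simp only [partitionColoring, G.part_eq_of_mem hB ha] at this
    rw [this]
  · intro c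
    classical
    let G := Finpartition.ofSetoid (Setoid.ker c)
    have hG : ∀ p q, q ∈ G.part p ↔ c p = c q := fun p q => by
      rw [Finpartition.mem_part_ofSetoid_iff_rel]; rfl
    have hne : ∀ B : G.parts, (B : Finset V).Nonempty := fun B => G.nonempty_of_mem_parts B.2
    have hpart : ∀ B : G.parts, G.part (hne B).choose = B := fun B =>
      G.part_eq_of_mem B.2 (hne B).choose_spec
    refine ⟨⟨G, ⟨fun B => c (hne B).choose, fun B B' h => ?_⟩⟩, ?_⟩
    · apply Subtype.ext
      rw [← hpart B, ← hpart B', ← G.mem_part_iff_part_eq_part (Finset.mem_univ _)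
        (Finset.mem_univ _), hG]
      exact h.symm
    · ext p
      simp only [partitionColoring]
      congr 1
      have h := hpart ⟨G.part p, G.part_mem.2 (Finset.mem_univ p)⟩
      simp only at h
      have h2 := (hG (hne ⟨G.part p, G.part_mem.2 (Finset.mem_univ p)⟩).choose p).1
      apply h2
      rw [h]
      exact G.mem_part_self.2 (Finset.mem_univ p)

/-- Summing over all colorings of a set the product over the colors of a function of the color
classes is the same as summing over all partitions. -/
lemma sum_coloring_eq [CommRing R] (f : Finset V → R) (hf : f ∅ = 1) (N : ℕ) :
    ∑ c : V → Fin N, ∏ i, f {p | c p = i} =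
      ∑ G : Finpartition (Finset.univ : Finset V),
        (N.descFactorial G.parts.card : R) * ∏ B ∈ G.parts, f B := by
  rw [← (partitionColoring_bijective (V := V) N).sum_comp, Fintype.sum_sigma]
  refine Finset.sum_congr rfl fun G _ => ?_
  have : ∀ e : G.parts ↪ Fin N,
      ∏ i, f {p | partitionColoring ⟨G, e⟩ p = i} = ∏ B ∈ G.parts, f B := fun e => by
    rw [← Finset.prod_coe_sort G.parts f]
    symm
    -- Colors outside the range of `e` have an empty class and contribute `f ∅ = 1`.
    refine Fintype.prod_of_injective e e.injective _ _ (fun i hi => ?_) fun B => ?_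
    · rw [← hf]
      congr 1
      ext p
      simp only [Finset.mem_filter, Finset.mem_univ, true_and, Finset.notMem_empty, iff_false]
      exact fun h => hi ⟨_, h⟩
    · congr 1
      ext p
      simp only [partitionColoring, Finset.mem_filter, Finset.mem_univ, true_and,
        EmbeddingLike.apply_eq_iff_eq, Subtype.ext_iff]
      exact (G.part_eq_iff_mem B.2).symm
  simp [this, Fintype.card_embedding_eq]

/-- The linear term of X(X-1)⋯(X-l+1) is the product of the constants -1, …, -(l-1). This is where
the truncation coefficients come from: the connected part is the linear coefficient of the coloring
polynomial. -/
lemma coeff_one_descPochhammer [CommRing R] [Nontrivial R] [NoZeroDivisors R] (l : ℕ)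
    (hl : l ≠ 0) :
    (descPochhammer R l).coeff 1 = (-1) ^ (l + 1) * ((l - 1).factorial : R) := by
  obtain ⟨l, rfl⟩ := Nat.exists_eq_succ_of_ne_zero hl
  clear hl
  induction l with
  | zero => simp
  | succ l ih =>
    have h0 : (descPochhammer R (l + 1)).coeff 0 = 0 := by
      rw [coeff_zero_eq_eval_zero, descPochhammer_ne_zero_eval_zero R (by omega)]
    rw [Nat.succ_eq_add_one] at ih ⊢
    rw [descPochhammer_succ_right, mul_sub, coeff_sub, coeff_mul_X, h0,
      ← C_eq_natCast, coeff_mul_C, ih, Nat.add_sub_cancel, Nat.add_sub_cancel, Nat.factorial_succ]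
    push_cast
    ring

/-- The polynomial in `N` whose values are the sums over all colorings with `N` colors. -/
noncomputable def coloringPolynomial [CommRing R] (f : Finset V → R) : R[X] :=
  ∑ G : Finpartition (Finset.univ : Finset V),
    descPochhammer R G.parts.card * C (∏ B ∈ G.parts, f B)

lemma eval_coloringPolynomial [CommRing R] (f : Finset V → R) (hf : f ∅ = 1) (N : ℕ) :
    (coloringPolynomial f).eval (N : R) = ∑ c : V → Fin N, ∏ i, f {p | c p = i} := by
  rw [sum_coloring_eq f hf, coloringPolynomial, eval_finsetSum]
  refine Finset.sum_congr rfl fun G _ => ?_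
  rw [eval_mul, eval_C, descPochhammer_eval_eq_descFactorial]

lemma card_parts_ne_zero [Nonempty V] (G : Finpartition (Finset.univ : Finset V)) :
    G.parts.card ≠ 0 :=
  (Finset.card_pos.2 (G.parts_nonempty (Finset.univ_nonempty.ne_empty))).ne'

lemma coeff_zero_coloringPolynomial [CommRing R] [Nonempty V] (f : Finset V → R) :
    (coloringPolynomial f).coeff 0 = 0 := by
  rw [coeff_zero_eq_eval_zero, coloringPolynomial, eval_finsetSum]
  refine Finset.sum_eq_zero fun G _ => ?_
  rw [eval_mul, descPochhammer_ne_zero_eval_zero R (card_parts_ne_zero G), zero_mul]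

lemma coeff_one_coloringPolynomial [CommRing R] [IsDomain R] [Nonempty V] (f : Finset V → R) :
    (coloringPolynomial f).coeff 1 = ∑ G : Finpartition (Finset.univ : Finset V),
      (-1) ^ (G.parts.card + 1) * ((G.parts.card - 1).factorial : R) * ∏ B ∈ G.parts, f B := by
  rw [coloringPolynomial, finsetSum_coeff]
  refine Finset.sum_congr rfl fun G _ => ?_
  rw [coeff_mul_C, coeff_one_descPochhammer _ (card_parts_ne_zero G)]

/-- A coloring is a pair of independent colorings of the two pieces, and each color class splits
accordingly. -/
lemma sum_coloring_mul [CommRing R] (P : V → Prop) [DecidablePred P] (f : Finset V → R)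
    (hf : ∀ S, f S = f (S.filter P) * f (S.filter fun p => ¬ P p)) (N : ℕ) :
    ∑ c : V → Fin N, ∏ i, f {p | c p = i} =
      (∑ c : {p // P p} → Fin N, ∏ i, f (({p | c p = i} : Finset _).map (.subtype _))) *
        ∑ c : {p // ¬ P p} → Fin N, ∏ i, f (({p | c p = i} : Finset _).map (.subtype _)) := by
  rw [Finset.sum_mul_sum, ← Finset.sum_product', Finset.univ_product_univ]
  refine Fintype.sum_equiv (Equiv.piEquivPiSubtypeProd P fun _ => Fin N) _ _ fun c => ?_
  rw [← Finset.prod_mul_distrib]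
  refine Finset.prod_congr rfl fun i _ => ?_
  rw [hf]
  congr 2
  · ext p
    simp [and_comm]
  · ext p
    simp [and_comm]

/-- The connected part of a set function vanishes if the function is multiplicative with respect
to a decomposition of the set into two nonempty pieces. -/
theorem sum_finpartition_eq_zero [CommRing R] [IsDomain R] [CharZero R] (P : V → Prop)
    [DecidablePred P] (h1 : ∃ p, P p) (h2 : ∃ p, ¬ P p) (f : Finset V → R) (hf0 : f ∅ = 1)
    (hf : ∀ S, f S = f (S.filter P) * f (S.filter fun p => ¬ P p)) :
    ∑ G : Finpartition (Finset.univ : Finset V),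
      (-1) ^ (G.parts.card + 1) * ((G.parts.card - 1).factorial : R) * ∏ B ∈ G.parts, f B = 0 := by
  obtain ⟨p1, hp1⟩ := h1
  obtain ⟨p2, hp2⟩ := h2
  have : Nonempty V := ⟨p1⟩
  have : Nonempty {p // P p} := ⟨⟨p1, hp1⟩⟩
  have : Nonempty {p // ¬ P p} := ⟨⟨p2, hp2⟩⟩
  have key : coloringPolynomial f =
      coloringPolynomial (fun S : Finset {p // P p} => f (S.map (.subtype _))) *
        coloringPolynomial (fun S : Finset {p // ¬ P p} => f (S.map (.subtype _))) := by
    -- Both sides agree at every natural number, and in characteristic zero there are infinitely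
    -- many of these.
    refine eq_of_infinite_eval_eq _ _ (Set.Infinite.mono ?_
      (Set.infinite_range_of_injective (Nat.cast_injective (R := R))))
    rintro _ ⟨N, rfl⟩
    rw [Set.mem_ofPred_eq, eval_mul, eval_coloringPolynomial _ hf0,
      eval_coloringPolynomial _ (by simpa using hf0),
      eval_coloringPolynomial _ (by simpa using hf0), sum_coloring_mul P f hf]
  -- A product of two polynomials without constant term has no linear term.
  rw [← coeff_one_coloringPolynomial, key, mul_coeff_one, coeff_zero_coloringPolynomial,
    coeff_zero_coloringPolynomial]
  simp

end Cumulants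

end ZeroCorrelation

namespace ZeroCorrelation

open Equiv Matrix

/-! ### Permanents -/

section Permanent

/-- Only permutations preserving both blocks contribute, and these are pairs of permutations. -/
lemma permanent_fromBlocks_zero {n₁ n₂ R : Type*} [Fintype n₁] [DecidableEq n₁] [Fintype n₂]
    [DecidableEq n₂] [CommRing R] (A : Matrix n₁ n₁ R) (D : Matrix n₂ n₂ R) :
    (fromBlocks A 0 0 D).permanent = A.permanent * D.permanent := by
  classical
  simp_rw [permanent]
  rw [Finset.sum_mul_sum, ← Finset.sum_product', Finset.univ_product_univ]
  have hinj : Function.Injective fun s : Perm n₁ × Perm n₂ => Perm.sumCongr s.1 s.2 :=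
    fun s t h => Perm.sumCongrHom_injective h
  symm
  refine Fintype.sum_of_injective _ hinj _ _ (fun σ hσ => ?_) fun s => ?_
  · have h1 : ¬ ∀ x, ∃ y, Sum.inl y = σ (Sum.inl x) := fun h => by
      have := Perm.mem_sumCongrHom_range_of_perm_mapsTo_inl (σ := σ)
        (by rintro _ ⟨x, rfl⟩; exact h x)
      obtain ⟨s, hs⟩ := this
      exact hσ ⟨s, hs⟩
    obtain ⟨a, ha⟩ := not_forall.1 h1
    rcases hx : σ (Sum.inl a) with a2 | b
    · exact absurd ⟨a2, hx.symm⟩ ha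
    · exact Finset.prod_eq_zero (Finset.mem_univ (Sum.inl a)) (by rw [hx]; rfl)
  · rw [Fintype.prod_sum_type]
    rfl

lemma permanent_submatrix_equiv_self {n n' R : Type*} [Fintype n] [DecidableEq n] [Fintype n']
    [DecidableEq n'] [CommRing R] (e : n' ≃ n) (A : Matrix n n R) :
    (A.submatrix e e).permanent = A.permanent := by
  simp_rw [permanent]
  refine Fintype.sum_equiv e.permCongr _ _ fun σ => ?_
  refine Fintype.prod_equiv e _ _ fun i => ?_
  simp

lemma map_permanent {n R S : Type*} [Fintype n] [DecidableEq n] [CommRing R] [CommRing S]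
    (f : R →+* S) (A : Matrix n n R) : f A.permanent = (A.map f).permanent := by
  simp [permanent, map_sum, map_prod]

end Permanent

/-! ### The Wick expansion as a polynomial in the covariance matrix -/

section WickSum

variable {V V' : Type*} [Fintype V] [DecidableEq V] [Fintype V'] [DecidableEq V'] {m k : ℕ}
  {R S : Type*} [CommRing R] [CommRing S]

/-- The matrix whose permanent is the contribution of the permutations `τ p` and the indices `q`
to the expectation of `∏ p, det (∑ q, ξ_{jq}^p conj ξ_{j'q}^p)`. -/
def wickMatrix (Λ : Matrix (V × Fin m) (V × Fin m) R) (τ : V → Perm (Fin k))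
    (q : V × Fin k → Fin m) : Matrix (V × Fin k) (V × Fin k) R :=
  of fun x y => if τ x.1 x.2 = y.2 then Λ (x.1, q x) (y.1, q y) else 0

/-- The expectation of `∏ p, det (∑ q, ξ_{jq}^p conj ξ_{j'q}^p)` as a polynomial in the
covariance matrix. -/
def wickSum (k : ℕ) (Λ : Matrix (V × Fin m) (V × Fin m) R) : R :=
  ∑ τ : V → Perm (Fin k), ∑ q : V × Fin k → Fin m,
    (∏ p, ((Perm.sign (τ p) : ℤ) : R)) * (wickMatrix Λ τ q).permanent

lemma map_wickSum (f : R →+* S) (Λ : Matrix (V × Fin m) (V × Fin m) R) :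
    f (wickSum k Λ) = wickSum k (Λ.map f) := by
  simp only [wickSum, map_sum, map_mul, map_prod, map_intCast, map_permanent]
  refine Finset.sum_congr rfl fun τ _ => Finset.sum_congr rfl fun q _ => ?_
  congr 2
  ext x y
  simp only [wickMatrix, map_apply, of_apply]
  split_ifs <;> simp

lemma wickSum_smul (c : R) (Λ : Matrix (V × Fin m) (V × Fin m) R) :
    wickSum k (c • Λ) = c ^ (Fintype.card V * k) * wickSum k Λ := by
  simp only [wickSum, Finset.mul_sum]
  refine Finset.sum_congr rfl fun τ _ => Finset.sum_congr rfl fun q _ => ?_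
  have : wickMatrix (c • Λ) τ q = c • wickMatrix Λ τ q := by
    ext x y
    simp [wickMatrix]
  rw [this, permanent_smul, Fintype.card_prod, Fintype.card_fin]
  ring

lemma wickSum_submatrix_equiv (e : V' ≃ V) (Λ : Matrix (V × Fin m) (V × Fin m) R) :
    wickSum k (Λ.submatrix (Prod.map e id) (Prod.map e id)) = wickSum k Λ := by
  simp only [wickSum]
  refine Fintype.sum_equiv (e.arrowCongr (Equiv.refl _)) _ _ fun τ => ?_
  refine Fintype.sum_equiv ((e.prodCongr (Equiv.refl _)).arrowCongr (Equiv.refl _)) _ _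
    fun q => ?_
  congr 1
  · exact Fintype.prod_equiv e _ _ fun p => by simp
  · rw [← permanent_submatrix_equiv_self (e.prodCongr (Equiv.refl _))]
    congr 1
    ext ⟨p, j⟩ ⟨p', j'⟩
    simp [wickMatrix]

/-- The choices of permutations and indices split over the two groups, and each Wick matrix becomes
block diagonal. -/
lemma wickSum_sum (Λ : Matrix ((V ⊕ V') × Fin m) ((V ⊕ V') × Fin m) R)
    (h12 : ∀ p q p' q', Λ (Sum.inl p, q) (Sum.inr p', q') = 0)
    (h21 : ∀ p q p' q', Λ (Sum.inr p, q) (Sum.inl p', q') = 0) :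
    wickSum k Λ = wickSum k (Λ.submatrix (Prod.map Sum.inl id) (Prod.map Sum.inl id)) *
      wickSum k (Λ.submatrix (Prod.map Sum.inr id) (Prod.map Sum.inr id)) := by
  simp only [wickSum]
  conv_rhs => rw [Fintype.sum_mul_sum, ← Fintype.sum_prod_type']
  refine Fintype.sum_equiv (Equiv.sumArrowEquivProdArrow V V' (Perm (Fin k))) _ _ fun τ => ?_
  conv_rhs => rw [Fintype.sum_mul_sum, ← Fintype.sum_prod_type']
  refine Fintype.sum_equiv (((Equiv.sumProdDistrib V V' (Fin k)).arrowCongr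
    (Equiv.refl _)).trans (Equiv.sumArrowEquivProdArrow (V × Fin k) (V' × Fin k) (Fin m))) _ _ fun q => ?_
  rw [mul_mul_mul_comm]
  congr 1
  · simp [Fintype.prod_sum_type]
  · rw [← permanent_fromBlocks_zero, ← permanent_submatrix_equiv_self
      (Equiv.sumProdDistrib V V' (Fin k)).symm]
    congr 1
    ext x y
    rcases x with ⟨p, j⟩ | ⟨p, j⟩ <;> rcases y with ⟨p', j'⟩ | ⟨p', j'⟩ <;>
      simp [wickMatrix, h12, h21]

end WickSum

/-! ### Correlation functions as functions of the joint covariance matrix -/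

section CorrelationOfMatrix

variable {V V₁ V₂ : Type*} [Fintype V] [DecidableEq V] [Fintype V₁] [DecidableEq V₁]
  [Fintype V₂] [DecidableEq V₂] {m k : ℕ} {R S F : Type*} [CommRing R] [CommRing S] [Field F]

/-- The covariance matrix of the values, as a block of a joint covariance matrix of the
values (`none`) and the derivatives (`some q`). -/
def valueBlock (M : Matrix (V × Option (Fin m)) (V × Option (Fin m)) R) : Matrix V V R :=
  M.submatrix (fun p => (p, none)) fun p => (p, none)

/-- The covariance matrix of the values with the derivatives. -/
def mixedBlock (M : Matrix (V × Option (Fin m)) (V × Option (Fin m)) R) :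
    Matrix V (V × Fin m) R :=
  M.submatrix (fun p => (p, none)) fun a => (a.1, some a.2)

/-- The covariance matrix of the derivatives with the values. -/
def mixedBlock' (M : Matrix (V × Option (Fin m)) (V × Option (Fin m)) R) :
    Matrix (V × Fin m) V R :=
  M.submatrix (fun a => (a.1, some a.2)) fun p => (p, none)

/-- The covariance matrix of the derivatives. -/
def derivBlock (M : Matrix (V × Option (Fin m)) (V × Option (Fin m)) R) :
    Matrix (V × Fin m) (V × Fin m) R :=
  M.submatrix (fun a => (a.1, some a.2)) fun a => (a.1, some a.2)

/-- The conditional covariance of the derivatives given the values. -/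
noncomputable def condCov (M : Matrix (V × Option (Fin m)) (V × Option (Fin m)) F) :
    Matrix (V × Fin m) (V × Fin m) F :=
  derivBlock M - mixedBlock' M * (valueBlock M)⁻¹ * mixedBlock M

/-- The conditional covariance of the derivatives given the values multiplied by the determinant
of the covariance matrix of the values. -/
def condCovNum (M : Matrix (V × Option (Fin m)) (V × Option (Fin m)) R) :
    Matrix (V × Fin m) (V × Fin m) R :=
  (valueBlock M).det • derivBlock M - mixedBlock' M * (valueBlock M).adjugate * mixedBlock M

/-- The zero correlation function as a function of the joint covariance matrix. -/
noncomputable def correlationOf (κ : F) (k : ℕ) (M : Matrix (V × Option (Fin m)) (V × Option (Fin m)) F) : F :=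
  κ ^ Fintype.card V * wickSum k (condCov M) / (valueBlock M).det ^ k

/-- The numerator of the zero correlation function. -/
def correlationNum (κ : R) (k : ℕ) (M : Matrix (V × Option (Fin m)) (V × Option (Fin m)) R) : R :=
  κ ^ Fintype.card V * wickSum k (condCovNum M)

/-- Using the adjugate in place of the inverse multiplies the conditional covariance by the
determinant. The Wick sum has degree `Fintype.card V * k`, and the additional `k` in the exponent
cancels the denominator of `correlationOf`. -/
lemma correlationNum_eq (κ : F) (M : Matrix (V × Option (Fin m)) (V × Option (Fin m)) F)
    (h : (valueBlock M).det ≠ 0) :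
    correlationNum κ k M =
      correlationOf κ k M * (valueBlock M).det ^ (Fintype.card V * k + k) := by
  have h1 : condCovNum M = (valueBlock M).det • condCov M := by
    rw [condCovNum, condCov, smul_sub, Matrix.inv_def, Ring.inverse_eq_inv']
    simp only [Matrix.mul_smul, Matrix.smul_mul, smul_smul, mul_inv_cancel₀ h, one_smul]
  rw [correlationNum, correlationOf, h1, wickSum_smul, pow_add]
  field_simp

lemma map_condCovNum (f : R →+* S) (M : Matrix (V × Option (Fin m)) (V × Option (Fin m)) R) :
    (condCovNum M).map f = condCovNum (M.map f) := by
  have h : (valueBlock M).map f = valueBlock (M.map f) := rfl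
  rw [condCovNum, condCovNum, ← h, ← RingHom.mapMatrix_apply, ← RingHom.mapMatrix_apply,
    ← RingHom.map_det, ← RingHom.map_adjugate, map_sub, RingHom.mapMatrix_apply,
    RingHom.mapMatrix_apply, RingHom.mapMatrix_apply, Matrix.map_mul, Matrix.map_mul]
  congr 1
  ext a b
  simp [derivBlock]

lemma map_correlationNum (f : R →+* S) (κ : R)
    (M : Matrix (V × Option (Fin m)) (V × Option (Fin m)) R) :
    f (correlationNum κ k M) = correlationNum (f κ) k (M.map f) := by
  rw [correlationNum, correlationNum, map_mul, map_pow, map_wickSum, map_condCovNum]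

lemma correlationOf_submatrix_equiv (e : V₁ ≃ V) (κ : F)
    (M : Matrix (V × Option (Fin m)) (V × Option (Fin m)) F) :
    correlationOf κ k (M.submatrix (Prod.map e id) (Prod.map e id)) = correlationOf κ k M := by
  have h1 : valueBlock (M.submatrix (Prod.map e id) (Prod.map e id)) =
      (valueBlock M).submatrix e e := rfl
  have h2 : condCov (M.submatrix (Prod.map e id) (Prod.map e id)) =
      (condCov M).submatrix (Prod.map e id) (Prod.map e id) := by
    have h3 : ((valueBlock M).submatrix e e)⁻¹ = ((valueBlock M)⁻¹).submatrix e e :=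
      inv_submatrix_equiv _ _ _
    rw [condCov, condCov, h1, h3]
    ext a b
    simp only [Matrix.sub_apply, submatrix_apply, Matrix.mul_apply]
    congr 1
    refine Fintype.sum_equiv e _ _ fun p => ?_
    congr 1
    exact Fintype.sum_equiv e _ _ fun p => rfl
  rw [correlationOf, correlationOf, h1, h2, wickSum_submatrix_equiv, det_submatrix_equiv_self,
    Fintype.card_congr e]

/-- The value block is block diagonal, hence so is its inverse. Conditioning on the values therefore
keeps the two groups uncorrelated. -/
lemma correlationOf_sum (κ : F)
    (M : Matrix ((V₁ ⊕ V₂) × Option (Fin m)) ((V₁ ⊕ V₂) × Option (Fin m)) F)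
    (h12 : ∀ p q p' q', M (Sum.inl p, q) (Sum.inr p', q') = 0)
    (h21 : ∀ p q p' q', M (Sum.inr p, q) (Sum.inl p', q') = 0)
    (h1 : (valueBlock (M.submatrix (Prod.map Sum.inl id) (Prod.map Sum.inl id))).det ≠ 0)
    (h2 : (valueBlock (M.submatrix (Prod.map Sum.inr id) (Prod.map Sum.inr id))).det ≠ 0) :
    correlationOf κ k M =
      correlationOf κ k (M.submatrix (Prod.map Sum.inl id) (Prod.map Sum.inl id)) *
      correlationOf κ k (M.submatrix (Prod.map Sum.inr id) (Prod.map Sum.inr id)) := by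
  set M₁ := M.submatrix (Prod.map Sum.inl id) (Prod.map (Sum.inl : V₁ → V₁ ⊕ V₂) id) with hM₁
  set M₂ := M.submatrix (Prod.map Sum.inr id) (Prod.map (Sum.inr : V₂ → V₁ ⊕ V₂) id) with hM₂
  have hA : valueBlock M = fromBlocks (valueBlock M₁) 0 0 (valueBlock M₂) := by
    ext a b
    rcases a with a | a <;> rcases b with b | b <;> simp [valueBlock, hM₁, hM₂, h12, h21]
  have hu1 : IsUnit (valueBlock M₁) := (isUnit_iff_isUnit_det _).2 h1.isUnit
  have hu2 : IsUnit (valueBlock M₂) := (isUnit_iff_isUnit_det _).2 h2.isUnit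
  have hinv : (valueBlock M)⁻¹ = fromBlocks (valueBlock M₁)⁻¹ 0 0 (valueBlock M₂)⁻¹ := by
    rw [hA, inv_fromBlocks_zero₂₁_of_isUnit_iff _ _ _ (by simp [hu1, hu2])]
    simp
  have hC1 : (condCov M).submatrix (Prod.map Sum.inl id) (Prod.map Sum.inl id) = condCov M₁ := by
    ext a b
    simp only [condCov, hinv, Matrix.sub_apply, submatrix_apply, Matrix.mul_apply, Fintype.sum_sum_type]
    simp [derivBlock, mixedBlock, mixedBlock', hM₁, h12, h21]
  have hC2 : (condCov M).submatrix (Prod.map Sum.inr id) (Prod.map Sum.inr id) = condCov M₂ := by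
    ext a b
    simp only [condCov, hinv, Matrix.sub_apply, submatrix_apply, Matrix.mul_apply, Fintype.sum_sum_type]
    simp [derivBlock, mixedBlock, mixedBlock', hM₂, h12, h21]
  have hC : wickSum k (condCov M) = wickSum k (condCov M₁) * wickSum k (condCov M₂) := by
    rw [wickSum_sum, hC1, hC2]
    · intro p q p' q'
      simp only [condCov, hinv, Matrix.sub_apply, Matrix.mul_apply, Fintype.sum_sum_type]
      simp [derivBlock, mixedBlock, mixedBlock', h12]
    · intro p q p' q'
      simp only [condCov, hinv, Matrix.sub_apply, Matrix.mul_apply, Fintype.sum_sum_type]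
      simp [derivBlock, mixedBlock, mixedBlock', h21]
  rw [correlationOf, correlationOf, correlationOf, hC, hA, det_fromBlocks_zero₂₁,
    Fintype.card_sum, pow_add, mul_pow]
  field_simp

/-- The part of a joint covariance matrix which belongs to a subset of the points. -/
def restrict (M : Matrix (V × Option (Fin m)) (V × Option (Fin m)) R) (S : Finset V) :
    Matrix (S × Option (Fin m)) (S × Option (Fin m)) R :=
  M.submatrix (Prod.map Subtype.val id) (Prod.map Subtype.val id)

/-- The decomposition of a finite set by a predicate. -/
def filterSumEquiv (P : V → Prop) [DecidablePred P] (S : Finset V) :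
    (S.filter P ⊕ S.filter fun p => ¬ P p) ≃ S where
  toFun := Sum.elim (fun p => ⟨p, (Finset.mem_filter.1 p.2).1⟩)
    fun p => ⟨p, (Finset.mem_filter.1 p.2).1⟩
  invFun p := if h : P p then Sum.inl ⟨p, Finset.mem_filter.2 ⟨p.2, h⟩⟩
    else Sum.inr ⟨p, Finset.mem_filter.2 ⟨p.2, h⟩⟩
  left_inv := by
    rintro (⟨p, hp⟩ | ⟨p, hp⟩)
    · simp [(Finset.mem_filter.1 hp).2]
    · simp [(Finset.mem_filter.1 hp).2]
  right_inv p := by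
    by_cases h : P p <;> simp [h]

omit [Fintype V] in
/-- The correlation function is multiplicative when the points of two sets are independent. -/
lemma correlationOf_restrict_mul (κ : F)
    (M : Matrix (V × Option (Fin m)) (V × Option (Fin m)) F) (P : V → Prop) [DecidablePred P]
    (h : ∀ a b, ¬ (P a.1 ↔ P b.1) → M a b = 0)
    (hdet : ∀ S, (valueBlock (restrict M S)).det ≠ 0) (S : Finset V) :
    correlationOf κ k (restrict M S) = correlationOf κ k (restrict M (S.filter P)) *
      correlationOf κ k (restrict M (S.filter fun p => ¬ P p)) := by
  rw [← correlationOf_submatrix_equiv (filterSumEquiv P S)]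
  refine correlationOf_sum _ _ ?_ ?_ (hdet (S.filter P)) (hdet (S.filter fun p => ¬ P p))
  · rintro ⟨p, hp⟩ q ⟨p', hp'⟩ q'
    refine h _ _ ?_
    simp [filterSumEquiv, (Finset.mem_filter.1 hp).2, (Finset.mem_filter.1 hp').2]
  · rintro ⟨p, hp⟩ q ⟨p', hp'⟩ q'
    refine h _ _ ?_
    simp [filterSumEquiv, (Finset.mem_filter.1 hp).2, (Finset.mem_filter.1 hp').2]

end CorrelationOfMatrix

end ZeroCorrelation

namespace ZeroCorrelation

open Equiv Matrix MvPolynomial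

/-! ### Invariance under the torus acting on the points -/

section WeightedHomogeneous

variable {τ R W : Type*} [CommRing R] [AddCommGroup W] {w : τ → W}

lemma isWeightedHomogeneous_intCast (n : ℤ) :
    IsWeightedHomogeneous w (n : MvPolynomial τ R) 0 := by
  have := isWeightedHomogeneous_C (R := R) w (n : R)
  rwa [map_intCast] at this

/-- A permutation of the rows does not change the sum of their weights, so all terms of the
expansion have the same weight. -/
lemma IsWeightedHomogeneous.det {ι : Type*} [Fintype ι] [DecidableEq ι]
    {M : Matrix ι ι (MvPolynomial τ R)} {u v : ι → W}
    (h : ∀ i j, IsWeightedHomogeneous w (M i j) (u i - v j)) :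
    IsWeightedHomogeneous w M.det (∑ i, u i - ∑ i, v i) := by
  rw [det_apply']
  refine IsWeightedHomogeneous.sum _ _ _ fun σ _ => ?_
  have := (isWeightedHomogeneous_intCast (R := R) (w := w) (Perm.sign σ)).mul
    (IsWeightedHomogeneous.prod Finset.univ (fun i => M (σ i) i) _ fun i _ => h (σ i) i)
  rwa [zero_add, Finset.sum_sub_distrib, Equiv.sum_comp σ u] at this

lemma IsWeightedHomogeneous.permanent {ι : Type*} [Fintype ι] [DecidableEq ι]
    {M : Matrix ι ι (MvPolynomial τ R)} {u : ι → W}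
    (h : ∀ i j, IsWeightedHomogeneous w (M i j) (u i - u j)) :
    IsWeightedHomogeneous w M.permanent 0 := by
  rw [Matrix.permanent]
  refine IsWeightedHomogeneous.sum _ _ _ fun σ _ => ?_
  have := IsWeightedHomogeneous.prod Finset.univ (fun i => M (σ i) i) _ fun i _ => h (σ i) i
  rwa [Finset.sum_sub_distrib, Equiv.sum_comp σ u, sub_self] at this

lemma IsWeightedHomogeneous.adjugate {ι : Type*} [Fintype ι] [DecidableEq ι]
    {M : Matrix ι ι (MvPolynomial τ R)} {u : ι → W}
    (h : ∀ i j, IsWeightedHomogeneous w (M i j) (u i - u j)) (i j : ι) :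
    IsWeightedHomogeneous w (M.adjugate i j) (u i - u j) := by
  rw [adjugate_apply]
  -- The new row `j` has a single entry 1, in column `i`. Assigning it the weight `u i` gives this
  -- entry weight 0, as required.
  have := IsWeightedHomogeneous.det (w := w) (M := M.updateRow j (Pi.single i 1))
    (u := Function.update u j (u i)) (v := u) fun a b => by
      rcases eq_or_ne a j with rfl | ha
      · rw [updateRow_self, Function.update_self]
        rcases eq_or_ne b i with rfl | hb
        · rw [Pi.single_eq_same, sub_self]
          exact isWeightedHomogeneous_one _ _
        · rw [Pi.single_eq_of_ne hb]
          exact isWeightedHomogeneous_zero _ _ _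
      · rw [updateRow_ne ha, Function.update_of_ne ha]
        exact h a b
  rwa [Finset.sum_update_of_mem (Finset.mem_univ j), Finset.sdiff_singleton_eq_erase,
    ← Finset.add_sum_erase Finset.univ u (Finset.mem_univ j), add_sub_add_right_eq_sub] at this

lemma IsWeightedHomogeneous.matrix_mul {ι κ l : Type*} [Fintype κ]
    {M : Matrix ι κ (MvPolynomial τ R)} {N : Matrix κ l (MvPolynomial τ R)}
    {u : ι → W} {v : κ → W} {x : l → W}
    (hM : ∀ i j, IsWeightedHomogeneous w (M i j) (u i - v j))
    (hN : ∀ i j, IsWeightedHomogeneous w (N i j) (v i - x j)) (i : ι) (j : l) :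
    IsWeightedHomogeneous w ((M * N) i j) (u i - x j) := by
  rw [Matrix.mul_apply]
  refine IsWeightedHomogeneous.sum _ _ _ fun p _ => ?_
  have := (hM i p).mul (hN p j)
  rwa [sub_add_sub_cancel] at this

variable {V : Type*} [Fintype V] [DecidableEq V] {m k : ℕ}

/-- The weights depend on the points alone, not on the indices `q`, so they cancel in every
permanent. -/
lemma isWeightedHomogeneous_wickSum {Λ : Matrix (V × Fin m) (V × Fin m) (MvPolynomial τ R)}
    {u : V → W} (h : ∀ a b, IsWeightedHomogeneous w (Λ a b) (u a.1 - u b.1)) :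
    IsWeightedHomogeneous w (wickSum k Λ) 0 := by
  refine IsWeightedHomogeneous.sum _ _ _ fun σ _ => IsWeightedHomogeneous.sum _ _ _ fun q _ => ?_
  have h1 := IsWeightedHomogeneous.prod Finset.univ
    (fun p => ((Perm.sign (σ p) : ℤ) : MvPolynomial τ R)) _
    fun p _ => isWeightedHomogeneous_intCast (w := w) _
  have h2 : IsWeightedHomogeneous w (wickMatrix Λ σ q).permanent 0 :=
    IsWeightedHomogeneous.permanent (u := fun x => u x.1) fun x y => by
      rw [wickMatrix, of_apply]
      split_ifs
      · exact h _ _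
      · exact isWeightedHomogeneous_zero _ _ _
  simpa using h1.mul h2

lemma isWeightedHomogeneous_valueBlock_det
    {M : Matrix (V × Option (Fin m)) (V × Option (Fin m)) (MvPolynomial τ R)} {u : V → W}
    (h : ∀ a b, IsWeightedHomogeneous w (M a b) (u a.1 - u b.1)) :
    IsWeightedHomogeneous w (valueBlock M).det 0 := by
  have := IsWeightedHomogeneous.det (w := w) (M := valueBlock M) (u := u) (v := u)
    fun p q => h _ _
  rwa [sub_self] at this

lemma isWeightedHomogeneous_correlationNum (κ : R)
    {M : Matrix (V × Option (Fin m)) (V × Option (Fin m)) (MvPolynomial τ R)} {u : V → W}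
    (h : ∀ a b, IsWeightedHomogeneous w (M a b) (u a.1 - u b.1)) :
    IsWeightedHomogeneous w (correlationNum (C κ) k M) 0 := by
  have hB : ∀ p b, IsWeightedHomogeneous w (mixedBlock M p b) (u p - u b.1) := fun p b => h _ _
  have hB' : ∀ a p, IsWeightedHomogeneous w (mixedBlock' M a p) (u a.1 - u p) := fun a p => h _ _
  have hA : ∀ p q, IsWeightedHomogeneous w (valueBlock M p q) (u p - u q) := fun p q => h _ _
  have h1 : ∀ a b, IsWeightedHomogeneous w (condCovNum M a b) (u a.1 - u b.1) := fun a b => by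
    refine IsWeightedHomogeneous.sub ?_ ?_
    · have := (isWeightedHomogeneous_valueBlock_det h).mul (h (a.1, some a.2) (b.1, some b.2))
      rwa [zero_add] at this
    · exact IsWeightedHomogeneous.matrix_mul (u := fun a => u a.1) (v := u) (x := fun a => u a.1)
        (IsWeightedHomogeneous.matrix_mul (u := fun a : V × Fin m => u a.1) (v := u) hB'
          (IsWeightedHomogeneous.adjugate hA)) hB a b
  have h2 := (isWeightedHomogeneous_C w κ).pow (Fintype.card V)
  have h3 := h2.mul (isWeightedHomogeneous_wickSum (k := k) h1)
  rw [correlationNum]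
  simpa using h3

end WeightedHomogeneous

/-! ### The numerator of the connected function as a universal polynomial -/

section Generic

variable (V : Type*) [DecidableEq V] (m : ℕ)

/-- The index set of the variables: pairs of indices of the joint covariance matrix. -/
abbrev EntryIndex : Type _ := (V × Option (Fin m)) × (V × Option (Fin m))

/-- The joint covariance matrix whose entries at pairs of distinct points are variables,
the covariance matrix of the values and derivatives at a single point being scalar. -/
noncomputable def genericMatrix (α : ℂ) :
    Matrix (V × Option (Fin m)) (V × Option (Fin m)) (MvPolynomial (EntryIndex V m) ℂ) :=
  of fun a b => if a.1 = b.1 then (if a = b then C α else 0) else X (a, b)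

/-- The weights of the variables under the action of a torus with one factor for each point. -/
def gaugeWeight (e : EntryIndex V m) : V → ℤ := Pi.single e.1.1 1 - Pi.single e.2.1 1

variable {V m}

lemma isWeightedHomogeneous_genericMatrix (α : ℂ) (a b : V × Option (Fin m)) :
    IsWeightedHomogeneous (gaugeWeight V m) (genericMatrix V m α a b)
      (Pi.single a.1 1 - Pi.single b.1 1) := by
  rw [genericMatrix, of_apply]
  split_ifs with h1 h2
  · rw [h1, sub_self]
    exact isWeightedHomogeneous_C _ _
  · exact isWeightedHomogeneous_zero _ _ _
  · exact isWeightedHomogeneous_X _ _ (a, b)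

variable [Fintype V]

/-- The numerator of the connected correlation function as a polynomial in the entries of the
joint covariance matrix. -/
noncomputable def connectedNum (α κ : ℂ) (k : ℕ) : MvPolynomial (EntryIndex V m) ℂ :=
  ∑ G : Finpartition (Finset.univ : Finset V),
    C ((-1) ^ (G.parts.card + 1) * ((G.parts.card - 1).factorial : ℂ)) *
      ((∏ B ∈ G.parts, correlationNum (C κ) k (restrict (genericMatrix V m α) B)) *
        ∏ B ∈ G.partsᶜ, (valueBlock (restrict (genericMatrix V m α) B)).det ^
          (Fintype.card B * k + k))

lemma isWeightedHomogeneous_connectedNum (α κ : ℂ) (k : ℕ) :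
    IsWeightedHomogeneous (gaugeWeight V m) (connectedNum (V := V) (m := m) α κ k) 0 := by
  refine IsWeightedHomogeneous.sum _ _ _ fun G _ => ?_
  let u : ∀ B : Finset V, B → V → ℤ := fun B p => Pi.single (p : V) 1
  have hM : ∀ (B : Finset V) (a b : B × Option (Fin m)),
      IsWeightedHomogeneous (gaugeWeight V m) (restrict (genericMatrix V m α) B a b)
        (Pi.single (a.1 : V) 1 - Pi.single (b.1 : V) 1) :=
    fun B a b => isWeightedHomogeneous_genericMatrix α ((a.1 : V), a.2) ((b.1 : V), b.2)
  have h1 := IsWeightedHomogeneous.prod G.parts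
    (fun B => correlationNum (C κ) k (restrict (genericMatrix V m α) B)) _
    fun B _ => isWeightedHomogeneous_correlationNum κ
      (u := u B) (hM B)
  have h2 := IsWeightedHomogeneous.prod G.partsᶜ
    (fun B => (valueBlock (restrict (genericMatrix V m α) B)).det ^ (Fintype.card B * k + k)) _
    fun B _ => (isWeightedHomogeneous_valueBlock_det
      (u := u B) (hM B)).pow _
  have h3 := (isWeightedHomogeneous_C (gaugeWeight V m)
    ((-1) ^ (G.parts.card + 1) * ((G.parts.card - 1).factorial : ℂ))).mul (h1.mul h2)
  simpa using h3

/-- The connected part of the correlation functions of a joint covariance matrix. -/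
noncomputable def connectedOf {F : Type*} [Field F] (κ : F) (k : ℕ)
    (M : Matrix (V × Option (Fin m)) (V × Option (Fin m)) F) : F :=
  ∑ G : Finpartition (Finset.univ : Finset V),
    (-1) ^ (G.parts.card + 1) * ((G.parts.card - 1).factorial : F) *
      ∏ B ∈ G.parts, correlationOf κ k (restrict M B)

/-- The common denominator runs over all subsets, so that it does not depend on the partition. The
parts of `G` use their factors to clear the fractions, and the remaining factors form the second
product in `connectedNum`. -/
lemma map_connectedNum {F : Type*} [Field F] (φ : MvPolynomial (EntryIndex V m) ℂ →+* F)
    (α κ : ℂ) (k : ℕ)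
    (h : ∀ S, φ (valueBlock (restrict (genericMatrix V m α) S)).det ≠ 0) :
    φ (connectedNum α κ k) = connectedOf (φ (C κ)) k ((genericMatrix V m α).map φ) *
      ∏ S : Finset V, φ (valueBlock (restrict (genericMatrix V m α) S)).det ^
        (Fintype.card S * k + k) := by
  have hdet : ∀ S, φ (valueBlock (restrict (genericMatrix V m α) S)).det =
      (valueBlock (restrict ((genericMatrix V m α).map φ) S)).det := fun S => by
    rw [RingHom.map_det]; rfl
  have hnum : ∀ S, φ (correlationNum (C κ) k (restrict (genericMatrix V m α) S)) =
      correlationOf (φ (C κ)) k (restrict ((genericMatrix V m α).map φ) S) *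
        φ (valueBlock (restrict (genericMatrix V m α) S)).det ^ (Fintype.card S * k + k) :=
    fun S => by
      rw [map_correlationNum, hdet, ← correlationNum_eq _ _ (hdet S ▸ h S)]; rfl
  rw [connectedNum, connectedOf, map_sum, Finset.sum_mul]
  refine Finset.sum_congr rfl fun G _ => ?_
  rw [← Finset.prod_mul_prod_compl G.parts]
  simp only [map_mul, map_prod, map_pow, hnum, Finset.prod_mul_distrib, map_neg, map_one,
    map_natCast]
  ring

lemma correlationOf_isEmpty {V F : Type*} [Fintype V] [DecidableEq V] [IsEmpty V] [Field F]
    (κ : F) (k : ℕ) (M : Matrix (V × Option (Fin m)) (V × Option (Fin m)) F) :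
    correlationOf κ k M = 1 := by
  simp [correlationOf, wickSum, permanent_isEmpty]

lemma connectedOf_eq_zero {F : Type*} [Field F] [CharZero F] (κ : F) (k : ℕ)
    (M : Matrix (V × Option (Fin m)) (V × Option (Fin m)) F) (P : V → Prop) [DecidablePred P]
    (h1 : ∃ p, P p) (h2 : ∃ p, ¬ P p) (h : ∀ a b, ¬ (P a.1 ↔ P b.1) → M a b = 0)
    (hdet : ∀ S, (valueBlock (restrict M S)).det ≠ 0) : connectedOf κ k M = 0 :=
  sum_finpartition_eq_zero P h1 h2 (fun S => correlationOf κ k (restrict M S))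
    (correlationOf_isEmpty _ _ _) (correlationOf_restrict_mul κ M P h hdet)

end Generic

/-! ### Vanishing when the points split into two uncorrelated groups -/

section Kill

variable {τ : Type*}

/-- Setting the variables outside a set to zero. -/
noncomputable def killVars (p : τ → Prop) [DecidablePred p] :
    MvPolynomial τ ℂ →ₐ[ℂ] MvPolynomial τ ℂ :=
  aeval fun e => if p e then X e else 0

/-- A monomial containing a killed variable disappears, and every other monomial is left unchanged.
-/
lemma coeff_killVars (p : τ → Prop) [DecidablePred p] (s : τ →₀ ℕ) (hs : ∀ e, ¬ p e → s e = 0)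
    (Q : MvPolynomial τ ℂ) : coeff s (killVars p Q) = coeff s Q := by
  classical
  induction Q using MvPolynomial.induction_on' with
  | add f g hf hg => simp [hf, hg]
  | monomial u a =>
    by_cases h : ∃ e, ¬ p e ∧ u e ≠ 0
    · obtain ⟨e, he, hu⟩ := h
      have h0 : killVars p (monomial u a) = 0 := by
        rw [killVars, aeval_monomial, Finsupp.prod,
          Finset.prod_eq_zero (Finsupp.mem_support_iff.2 hu) (by simp [he, hu]), mul_zero]
      rw [h0, coeff_monomial, if_neg, coeff_zero]
      rintro rfl
      exact hu (hs e he)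
    · push Not at h
      have h0 : killVars p (monomial u a) = monomial u a := by
        rw [killVars, aeval_monomial, monomial_eq]
        congr 1
        refine Finset.prod_congr rfl fun e he => ?_
        have hp : p e := by
          by_contra hp
          exact Finsupp.mem_support_iff.1 he (h e hp)
        simp [hp]
      rw [h0]

end Kill

section Vanishing

variable {V : Type*} [DecidableEq V] [Fintype V] {m : ℕ}

lemma killVars_connectedNum (α κ : ℂ) (hα : α ≠ 0) (k : ℕ) (P : V → Prop) [DecidablePred P]
    (h1 : ∃ p, P p) (h2 : ∃ p, ¬ P p) :
    killVars (fun e : EntryIndex V m => (P e.1.1 ↔ P e.2.1)) (connectedNum α κ k) = 0 := by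
  set ρ := killVars (fun e : EntryIndex V m => (P e.1.1 ↔ P e.2.1)) with hρ
  -- Correlation functions involve division, so the factorization is carried out in the field of
  -- fractions.
  let φ : MvPolynomial (EntryIndex V m) ℂ →+* FractionRing (MvPolynomial (EntryIndex V m) ℂ) :=
    (algebraMap _ _).comp ρ.toRingHom
  have hinj : Function.Injective (algebraMap (MvPolynomial (EntryIndex V m) ℂ)
    (FractionRing (MvPolynomial (EntryIndex V m) ℂ))) := IsFractionRing.injective _ _
  have hdet : ∀ S, φ (valueBlock (restrict (genericMatrix V m α) S)).det ≠ 0 := fun S h0 => by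
    have h3 : ρ (valueBlock (restrict (genericMatrix V m α) S)).det = 0 :=
      hinj (h0.trans (map_zero _).symm)
    -- The determinants are nonzero polynomials: with all variables set to zero the value block is
    -- `α • 1`.
    let ψ : MvPolynomial (EntryIndex V m) ℂ →+* ℂ :=
      (eval (fun _ => (0 : ℂ))).comp ρ.toRingHom
    have h4 : ψ (valueBlock (restrict (genericMatrix V m α) S)).det = 0 := by
      simp [ψ, h3]
    have h5 : ψ.mapMatrix (valueBlock (restrict (genericMatrix V m α) S)) = α • 1 := by
      ext p q
      by_cases hpq : p = q
      · subst hpq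
        simp [valueBlock, restrict, genericMatrix, ψ, hρ, killVars]
      · have : (p : V) ≠ q := fun h => hpq (Subtype.ext h)
        simp only [RingHom.mapMatrix_apply, map_apply, valueBlock, restrict, genericMatrix,
          submatrix_apply, of_apply, Prod.map_apply, this, if_false, Matrix.smul_apply,
          one_apply_ne hpq, smul_zero]
        have h6 : ∀ e, ψ (X e) = 0 := fun e => by
          by_cases he : (P e.1.1 ↔ P e.2.1) <;> simp [ψ, hρ, killVars, he]
        exact h6 _
    rw [RingHom.map_det, h5, det_smul, det_one, mul_one] at h4
    exact pow_ne_zero _ hα h4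
  have hzero : connectedOf (φ (C κ)) k ((genericMatrix V m α).map φ) = 0 := by
    refine connectedOf_eq_zero _ _ _ P h1 h2 (fun a b hab => ?_) fun S => ?_
    · have hne : a.1 ≠ b.1 := fun h => hab (by rw [h])
      simp [genericMatrix, hne, φ, hρ, killVars, hab]
    · have := hdet S
      rw [RingHom.map_det] at this
      exact this
  refine hinj ?_
  rw [map_zero]
  have := map_connectedNum φ α κ k hdet
  rw [hzero, zero_mul] at this
  exact this

end Vanishing

/-! ### From monomials to graphs -/

section Bound

variable {V : Type*} [DecidableEq V] [Fintype V] {m : ℕ}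

/-- The graph of a monomial: a variable is an edge between its two points. -/
def monomialGraph (s : EntryIndex V m →₀ ℕ) (p q : V) : ℕ :=
  ∑ a : Option (Fin m), ∑ b : Option (Fin m), s ((p, a), (q, b))

omit [DecidableEq V] in
lemma prod_pow_monomialGraph (s : EntryIndex V m →₀ ℕ) (w : V → V → ℝ) :
    ∏ e : EntryIndex V m, w e.1.1 e.2.1 ^ s e = ∏ p, ∏ q, w p q ^ monomialGraph s p q := by
  simp only [Fintype.prod_prod_type, monomialGraph, ← Finset.prod_pow_eq_pow_sum]
  exact Finset.prod_congr rfl fun p _ => Finset.prod_comm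

/-- The component of the weight at a vertex is its out-degree minus its in-degree. -/
lemma zeroBoundary_monomialGraph (s : EntryIndex V m →₀ ℕ)
    (hs : Finsupp.weight (gaugeWeight V m) s = 0) : ZeroBoundary (monomialGraph s) := by
  intro v
  have h : ∑ e : EntryIndex V m, (s e : ℤ) * gaugeWeight V m e v = 0 := by
    have := congrFun hs v
    rw [Finsupp.weight_apply, Finsupp.sum_fintype _ _ (by simp)] at this
    simpa using this
  simp only [gaugeWeight, Pi.sub_apply, mul_sub, Finset.sum_sub_distrib, sub_eq_zero,
    Pi.single_apply, mul_ite, mul_one, mul_zero, Fintype.sum_prod_type] at h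
  have h1 : ∑ p : V, ∑ a : Option (Fin m), ∑ q : V, ∑ b : Option (Fin m),
      (if v = p then (s ((p, a), (q, b)) : ℤ) else 0) = ∑ q, (monomialGraph s v q : ℤ) := by
    rw [Finset.sum_eq_single v (by intro p _ hp; simp [hp.symm]) (by simp), Finset.sum_comm]
    simp [monomialGraph]
  have h2 : ∑ p : V, ∑ a : Option (Fin m), ∑ q : V, ∑ b : Option (Fin m),
      (if v = q then (s ((p, a), (q, b)) : ℤ) else 0) = ∑ p, (monomialGraph s p v : ℤ) := by
    refine Finset.sum_congr rfl fun p _ => ?_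
    rw [monomialGraph]
    push_cast
    refine Finset.sum_congr rfl fun a _ => ?_
    rw [Finset.sum_eq_single v (by intro p _ hp; simp [hp.symm]) (by simp)]
    simp
  rw [h1, h2] at h
  exact_mod_cast h

/-- A polynomial in the entries which is gauge invariant and vanishes whenever the points are
separated into two independent sets has only monomials which belong to connected graphs with
zero boundary; therefore it is bounded by the maximal weight of such a graph. -/
lemma exists_bound_of_gaugeInvariant (Q : MvPolynomial (EntryIndex V m) ℂ)
    (hQ : IsWeightedHomogeneous (gaugeWeight V m) Q 0)
    (hconn : ∀ (P : V → Prop) [DecidablePred P], (∃ p, P p) → (∃ p, ¬ P p) →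
      killVars (fun e : EntryIndex V m => (P e.1.1 ↔ P e.2.1)) Q = 0) (M : ℝ) (hM : 0 ≤ M) :
    ∃ C, 0 ≤ C ∧ ∀ (z : V → EuclideanSpace ℂ (Fin m)) (x : EntryIndex V m → ℂ),
      (∀ e, ‖x e‖ ≤ M * (‖z e.1.1 - z e.2.1‖ ^ 2 * Real.exp (-‖z e.1.1 - z e.2.1‖ ^ 2 / 2))) →
        ‖eval x Q‖ ≤ C * graphDecay z := by
  refine ⟨∑ s ∈ Q.support, ‖coeff s Q‖ * ∏ e, M ^ s e, by positivity, fun z x hx => ?_⟩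
  rw [eval_eq', Finset.sum_mul]
  refine (norm_sum_le _ _).trans (Finset.sum_le_sum fun s hs => ?_)
  rw [norm_mul, norm_prod, mul_assoc]
  refine mul_le_mul_of_nonneg_left ?_ (norm_nonneg _)
  have hbd : ZeroBoundary (monomialGraph s) :=
    zeroBoundary_monomialGraph s (hQ (mem_support_iff.1 hs))
  have hcn : GraphConnected (monomialGraph s) := by
    intro p q
    by_contra hpq
    classical
    -- Let `P` be the connected component of `p`. No variable of the monomial leaves `P`, so its
    -- coefficient survives `killVars`, although `killVars` annihilates `Q`.
    let P : V → Prop := fun r => Relation.ReflTransGen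
      (fun a b => 0 < monomialGraph s a b ∨ 0 < monomialGraph s b a) p r
    have h0 := hconn P ⟨p, .refl⟩ ⟨q, hpq⟩
    have h1 := coeff_killVars (fun e : EntryIndex V m => (P e.1.1 ↔ P e.2.1)) s
      (fun e he => by
        by_contra hse
        have hpos : 0 < monomialGraph s e.1.1 e.2.1 :=
          (Nat.pos_of_ne_zero hse).trans_le <|
            (Finset.single_le_sum (f := fun b => s ((e.1.1, e.1.2), (e.2.1, b)))
              (fun _ _ => Nat.zero_le _) (Finset.mem_univ e.2.2)).trans
            (Finset.single_le_sum (f := fun a => ∑ b, s ((e.1.1, a), (e.2.1, b)))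
              (fun _ _ => Nat.zero_le _) (Finset.mem_univ e.1.2))
        exact he ⟨fun h => h.tail (Or.inl hpos), fun h => h.tail (Or.inr hpos)⟩) Q
    rw [h0, coeff_zero] at h1
    exact mem_support_iff.1 hs h1.symm
  calc ∏ e, ‖x e ^ s e‖
      ≤ ∏ e : EntryIndex V m, (M * (‖z e.1.1 - z e.2.1‖ ^ 2 *
          Real.exp (-‖z e.1.1 - z e.2.1‖ ^ 2 / 2))) ^ s e :=
        Finset.prod_le_prod (fun e _ => norm_nonneg _) fun e _ => by
          rw [norm_pow]
          exact pow_le_pow_left₀ (norm_nonneg _) (hx e) _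
    _ = (∏ e, M ^ s e) * graphWeight z (monomialGraph s) := by
        simp only [mul_pow M, Finset.prod_mul_distrib]
        congr 1
        exact prod_pow_monomialGraph s fun p q =>
          ‖z p - z q‖ ^ 2 * Real.exp (-‖z p - z q‖ ^ 2 / 2)
    _ ≤ (∏ e, M ^ s e) * graphDecay z :=
        mul_le_mul_of_nonneg_left ((isGreatest_graphDecay z).2 ⟨_, hcn, hbd, rfl⟩)
          (by positivity)

end Bound

end ZeroCorrelation

namespace ZeroCorrelation

open Matrix
open scoped ComplexConjugate ComplexOrder

variable {V : Type*} [Fintype V] {m : ℕ}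

/-! ### A lower bound for the kernel exp⟨w, z⟩ by interpolation -/

section ExpKernel

/-- The quadratic form of the kernel `exp ⟨w, z⟩` on the points `y` with the coefficients `x`. -/
noncomputable def expForm (y : V → EuclideanSpace ℂ (Fin m)) (x : V → ℂ) : ℂ :=
  ∑ p, ∑ p', conj (x p) * (x p' * Complex.exp (inner ℂ (y p') (y p)))

lemma inner_pow_div_factorial (v w : EuclideanSpace ℂ (Fin m)) (n : ℕ) :
    inner ℂ w v ^ n / (n.factorial : ℂ) =
      1 / (n.factorial : ℂ) * ∑ i : Fin n → Fin m, (∏ l, v (i l)) * conj (∏ l, w (i l)) := by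
  have h : inner ℂ w v = ∑ q, v q * conj (w q) := by simp [PiLp.inner_apply]
  rw [h, Fintype.sum_pow, div_eq_mul_one_div, mul_comm]
  simp only [map_prod, Finset.prod_mul_distrib]

/-- The exponential series writes the form as a weighted sum of squares of the functional f ↦ ∑
conj(x_p) f(y_p) on monomials. -/
lemma hasSum_expForm (y : V → EuclideanSpace ℂ (Fin m)) (x : V → ℂ) :
    HasSum (fun n : ℕ => ((1 / (n.factorial : ℝ) *
      ∑ i : Fin n → Fin m, ‖∑ p, conj (x p) * ∏ l, y p (i l)‖ ^ 2 : ℝ) : ℂ)) (expForm y x) := by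
  have hexp : ∀ u : ℂ, HasSum (fun n : ℕ => u ^ n / (n.factorial : ℂ)) (Complex.exp u) :=
    fun u => by
      rw [Complex.exp_eq_exp_ℂ]
      exact NormedSpace.expSeries_div_hasSum_exp u
  have h : HasSum (fun n : ℕ => ∑ p, ∑ p', conj (x p) * (x p' *
      (inner ℂ (y p') (y p) ^ n / (n.factorial : ℂ)))) (expForm y x) := by
    refine hasSum_sum fun p _ => hasSum_sum fun p' _ => ?_
    exact ((hexp (inner ℂ (y p') (y p))).mul_left (x p')).mul_left (conj (x p))
  convert h using 2 with n
  simp only [inner_pow_div_factorial]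
  push_cast
  have h1 : ∀ i : Fin n → Fin m, ((‖∑ p, conj (x p) * ∏ l, y p (i l)‖ : ℂ)) ^ 2 =
      ∑ p, ∑ p', (conj (x p) * ∏ l, y p (i l)) * (x p' * conj (∏ l, y p' (i l))) := fun i => by
    rw [← Complex.mul_conj', map_sum, Finset.sum_mul_sum]
    simp
  simp only [h1, Finset.mul_sum]
  rw [Finset.sum_comm]
  refine Finset.sum_congr rfl fun p _ => ?_
  rw [Finset.sum_comm]
  refine Finset.sum_congr rfl fun p' _ => Finset.sum_congr rfl fun i _ => ?_
  ring

lemma expForm_nonneg (y : V → EuclideanSpace ℂ (Fin m)) (x : V → ℂ) : 0 ≤ expForm y x := by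
  refine (hasSum_expForm y x).nonneg fun n => ?_
  exact_mod_cast (by positivity : (0 : ℝ) ≤ 1 / (n.factorial : ℝ) *
      ∑ i : Fin n → Fin m, ‖∑ p, conj (x p) * ∏ l, y p (i l)‖ ^ 2)

/-- One square is at most the whole series. The list `l` encodes a monomial by its coordinate
indices. -/
lemma sq_norm_le_expForm (y : V → EuclideanSpace ℂ (Fin m)) (x : V → ℂ) (l : List (Fin m)) :
    ‖∑ p, conj (x p) * (l.map (y p)).prod‖ ^ 2 ≤ l.length.factorial * (expForm y x).re := by
  have h := ((Complex.hasSum_iff _ _).1 (hasSum_expForm y x)).1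
  simp only [Complex.ofReal_re] at h
  have h1 := le_hasSum h l.length fun _ _ => by positivity
  have h2 := Finset.single_le_sum
    (f := fun i : Fin l.length → Fin m => ‖∑ p, conj (x p) * ∏ j, y p (i j)‖ ^ 2)
    (fun _ _ => by positivity) (Finset.mem_univ l.get)
  have h3 : ∀ p, ∏ j, y p (l.get j) = (l.map (y p)).prod := fun p => by
    rw [← List.prod_ofFn]
    congr 1
    exact List.ext_get (by simp) fun _ _ _ => by simp
  simp only [h3] at h2
  have hpos : (0 : ℝ) < l.length.factorial := by positivity
  rw [one_div, inv_mul_le_iff₀ hpos] at h1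
  exact h2.trans h1

/-- Multiplying monomials by factors `1 - ⟨z_q, z⟩ / |z_q|²` increases the bounds on a
functional only by a factor. -/
lemma norm_functional_prod_le [DecidableEq V] (y : V → EuclideanSpace ℂ (Fin m)) (a : V → ℂ)
    {c b : ℝ} (hc : 0 < c) (N : ℕ)
    (hb : ∀ l : List (Fin m), l.length ≤ N → ‖∑ p, a p * (l.map (y p)).prod‖ ≤ b)
    (W : Finset V) (hW : ∀ q ∈ W, c ≤ ‖y q‖) (l : List (Fin m)) (hl : l.length + W.card ≤ N) :
    ‖∑ p, a p * ((∏ q ∈ W, (1 - inner ℂ (y q) (y p) / (‖y q‖ : ℂ) ^ 2)) *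
      (l.map (y p)).prod)‖ ≤ (1 + m / c) ^ W.card * b := by
  induction W using Finset.induction_on generalizing l with
  | empty => simpa using hb l (by simpa using hl)
  | insert q W hq ih =>
    rw [Finset.card_insert_of_notMem hq] at hl ⊢
    have ih' := ih fun q hq => hW q (Finset.mem_insert_of_mem hq)
    have hyq : c ≤ ‖y q‖ := hW q (Finset.mem_insert_self q W)
    have hyq0 : 0 < ‖y q‖ := hc.trans_le hyq
    -- Expanding the new factor gives the old expression and `m` further ones, each with one more
    -- coordinate in the monomial and a coefficient of size at most 1/c.
    have hexp : ∑ p, a p * ((∏ q ∈ insert q W, (1 - inner ℂ (y q) (y p) / (‖y q‖ : ℂ) ^ 2)) *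
        (l.map (y p)).prod) =
        (∑ p, a p * ((∏ q ∈ W, (1 - inner ℂ (y q) (y p) / (‖y q‖ : ℂ) ^ 2)) *
          (l.map (y p)).prod)) -
        ∑ r, conj (y q r) / (‖y q‖ : ℂ) ^ 2 *
          ∑ p, a p * ((∏ q ∈ W, (1 - inner ℂ (y q) (y p) / (‖y q‖ : ℂ) ^ 2)) *
            ((r :: l).map (y p)).prod) := by
      simp only [Finset.mul_sum]
      rw [Finset.sum_comm, ← Finset.sum_sub_distrib]
      refine Finset.sum_congr rfl fun p _ => ?_
      have hin : inner ℂ (y q) (y p) = ∑ r, y p r * conj (y q r) := by simp [PiLp.inner_apply]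
      rw [Finset.prod_insert hq, hin, Finset.sum_div, sub_mul, one_mul, sub_mul, mul_sub,
        Finset.sum_mul, Finset.sum_mul, Finset.mul_sum]
      congr 1
      refine Finset.sum_congr rfl fun r _ => ?_
      rw [List.map_cons, List.prod_cons]
      ring
    rw [hexp]
    refine (norm_sub_le _ _).trans ?_
    have h1 := ih' l (by omega)
    have h2 : ∀ r, ‖conj (y q r) / (‖y q‖ : ℂ) ^ 2 *
          ∑ p, a p * ((∏ q ∈ W, (1 - inner ℂ (y q) (y p) / (‖y q‖ : ℂ) ^ 2)) *
            ((r :: l).map (y p)).prod)‖ ≤ 1 / c * ((1 + m / c) ^ W.card * b) := fun r => by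
      rw [norm_mul]
      refine mul_le_mul ?_ (ih' (r :: l) (by simp; omega)) (norm_nonneg _) (by positivity)
      rw [norm_div, norm_pow, Complex.norm_real, norm_norm, RCLike.norm_conj,
        div_le_div_iff₀ (by positivity) hc]
      have := PiLp.norm_apply_le (y q) r
      nlinarith [norm_nonneg (y q r)]
    have h3 := (norm_sum_le _ _).trans (Finset.sum_le_sum fun r (_ : r ∈ Finset.univ) => h2 r)
    rw [Finset.sum_const, Finset.card_univ, Fintype.card_fin, nsmul_eq_mul] at h3
    calc _ ≤ _ := add_le_add h1 h3
      _ = _ := by ring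

/-- A lower bound for the kernel `exp ⟨w, z⟩` if one of the points is `0` and the others are
bounded away from it. -/
lemma sq_norm_le_expForm_of_eq_zero [DecidableEq V] (y : V → EuclideanSpace ℂ (Fin m))
    (x : V → ℂ) {c : ℝ} (hc : 0 < c) (p₀ : V) (h0 : y p₀ = 0) (hy : ∀ p, p ≠ p₀ → c ≤ ‖y p‖) :
    ‖x p₀‖ ^ 2 ≤ ((1 + m / c) ^ Fintype.card V) ^ 2 * (Fintype.card V).factorial *
      (expForm y x).re := by
  have hre : 0 ≤ (expForm y x).re := (Complex.nonneg_iff.1 (expForm_nonneg y x)).1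
  set b := √((Fintype.card V).factorial * (expForm y x).re) with hb
  have h := norm_functional_prod_le y (fun p => conj (x p)) hc (b := b)
    (Fintype.card V) (fun l hl => by
      refine Real.le_sqrt_of_sq_le ((sq_norm_le_expForm y x l).trans ?_)
      exact mul_le_mul_of_nonneg_right (by exact_mod_cast Nat.factorial_le hl) hre)
    (Finset.univ.erase p₀) (fun q hq => hy q (Finset.ne_of_mem_erase hq)) []
    (by simp)
  -- The product over the other points is an interpolation polynomial: it is 1 at the origin and 0
  -- at those points, so only `x p₀` remains.
  rw [Finset.sum_eq_single p₀] at h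
  · simp only [h0, inner_zero_right, zero_div, sub_zero, Finset.prod_const_one, List.map_nil,
      List.prod_nil, mul_one, RCLike.norm_conj] at h
    have hle : (1 + m / c) ^ (Finset.univ.erase p₀).card ≤ (1 + m / c) ^ Fintype.card V :=
      pow_le_pow_right₀ (le_add_of_nonneg_right (by positivity)) (Finset.card_le_univ _)
    have h2 := h.trans (mul_le_mul_of_nonneg_right hle (Real.sqrt_nonneg _))
    calc ‖x p₀‖ ^ 2 ≤ ((1 + m / c) ^ Fintype.card V * b) ^ 2 :=
          pow_le_pow_left₀ (norm_nonneg _) h2 2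
      _ = _ := by rw [mul_pow, hb, Real.sq_sqrt (by positivity), mul_assoc]
  · intro p _ hp
    rw [Finset.prod_eq_zero (Finset.mem_erase.2 ⟨hp, Finset.mem_univ p⟩), zero_mul, mul_zero]
    rw [inner_self_eq_norm_sq_to_K, sub_eq_zero]
    refine (div_self ?_).symm
    exact pow_ne_zero _ (RCLike.ofReal_ne_zero.2 (hc.trans_le (hy p hp)).ne')
  · simp

end ExpKernel

/-! ### The covariance matrix of the values is uniformly positive -/

section Szego

lemma szegoKernel_eq_inner (z w : EuclideanSpace ℂ (Fin m)) :
    szegoKernel z w = 1 / (Real.pi : ℂ) ^ m *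
      Complex.exp (inner ℂ w z - (‖z‖ : ℂ) ^ 2 / 2 - (‖w‖ : ℂ) ^ 2 / 2) := by
  have h : ∑ q, z q * conj (w q) = inner ℂ w z := by simp [PiLp.inner_apply]
  have h2 : ((‖z - w‖ ^ 2 / 2 : ℝ) : ℂ) =
      ((‖z‖ : ℂ) ^ 2 - inner ℂ w z - conj (inner ℂ w z) + (‖w‖ : ℂ) ^ 2) / 2 := by
    have := inner_self_eq_norm_sq_to_K (𝕜 := ℂ) (z - w)
    rw [inner_sub_left, inner_sub_right, inner_sub_right, inner_self_eq_norm_sq_to_K,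
      inner_self_eq_norm_sq_to_K] at this
    push_cast
    rw [inner_conj_symm]
    simp only [Complex.coe_algebraMap] at this
    rw [← this]
    ring
  have h3 : Complex.I * ((inner ℂ w z : ℂ).im : ℂ) = (inner ℂ w z - conj (inner ℂ w z)) / 2 := by
    rw [Complex.sub_conj]
    push_cast
    ring
  rw [szegoKernel, h, h2, h3]
  congr 2
  ring

/-- The factor by which the Szegő kernel changes under a translation. -/
noncomputable def translationFactor (t z : EuclideanSpace ℂ (Fin m)) : ℂ :=
  Complex.exp (inner ℂ t z - (‖z‖ : ℂ) ^ 2 / 2 - (‖t‖ : ℂ) ^ 2 / 2)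

lemma translationFactor_self (t : EuclideanSpace ℂ (Fin m)) : translationFactor t t = 1 := by
  rw [translationFactor, inner_self_eq_norm_sq_to_K, ← Complex.exp_zero]
  congr 1
  simp only [Complex.coe_algebraMap]
  ring

/-- Up to diagonal factors, any chosen point may be moved to the origin. The factor at that point is
1 by `translationFactor_self`. -/
lemma szegoKernel_eq_translate (t z w : EuclideanSpace ℂ (Fin m)) :
    szegoKernel z w = 1 / (Real.pi : ℂ) ^ m * (translationFactor t z *
      (conj (translationFactor t w) * Complex.exp (inner ℂ (w - t) (z - t)))) := by
  rw [szegoKernel_eq_inner, translationFactor, translationFactor, ← Complex.exp_conj,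
    ← Complex.exp_add, ← Complex.exp_add]
  congr 2
  simp only [map_sub, map_div₀, map_pow, Complex.conj_ofReal, inner_conj_symm, inner_sub_left,
    inner_sub_right, inner_self_eq_norm_sq_to_K, Complex.coe_algebraMap, map_ofNat]
  ring

lemma szegoKernel_conj (z w : EuclideanSpace ℂ (Fin m)) :
    conj (szegoKernel z w) = szegoKernel w z := by
  rw [szegoKernel_eq_inner, szegoKernel_eq_inner, map_mul, ← Complex.exp_conj]
  simp only [map_sub, map_div₀, map_pow, Complex.conj_ofReal, inner_conj_symm, map_ofNat, map_one]
  congr 2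
  ring

omit [Fintype V] in
lemma matA_isHermitian (z : V → EuclideanSpace ℂ (Fin m)) : (matA z).IsHermitian := by
  ext p q
  simp [matA, szegoKernel_conj]

lemma star_dotProduct_matA_mulVec (z : V → EuclideanSpace ℂ (Fin m)) (x : V → ℂ)
    (t : EuclideanSpace ℂ (Fin m)) :
    star x ⬝ᵥ (matA z *ᵥ x) = ((1 / Real.pi ^ m : ℝ) : ℂ) *
      expForm (fun p => z p - t) fun p => conj (translationFactor t (z p)) * x p := by
  simp only [dotProduct, mulVec, matA, of_apply, Finset.mul_sum, expForm, Pi.star_apply]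
  refine Finset.sum_congr rfl fun p _ => Finset.sum_congr rfl fun p' _ => ?_
  rw [szegoKernel_eq_translate t]
  simp only [map_mul, Complex.conj_conj]
  push_cast
  simp only [RCLike.star_def]
  ring

/-- The lower bound for the covariance matrix of the values at separated points. -/
noncomputable def gramBound (v m : ℕ) (c : ℝ) : ℝ :=
  (v * (((1 + m / c) ^ v) ^ 2 * v.factorial * Real.pi ^ m))⁻¹

lemma gramBound_pos {v : ℕ} (hv : v ≠ 0) (m : ℕ) {c : ℝ} (hc : 0 < c) : 0 < gramBound v m c := by
  have : (0 : ℝ) < v := by exact_mod_cast Nat.pos_of_ne_zero hv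
  rw [gramBound]
  positivity

variable [DecidableEq V]

/-- Each coordinate of `x` is bounded by moving its point to the origin. Summing these bounds
produces the factor `v` in `gramBound`. -/
lemma gramBound_mul_le (z : V → EuclideanSpace ℂ (Fin m)) (x : V → ℂ) {c : ℝ} (hc : 0 < c)
    (hz : ∀ p q, p ≠ q → c ≤ ‖z p - z q‖) :
    gramBound (Fintype.card V) m c * ∑ p, ‖x p‖ ^ 2 ≤ (star x ⬝ᵥ (matA z *ᵥ x)).re := by
  set K : ℝ := ((1 + m / c) ^ Fintype.card V) ^ 2 * (Fintype.card V).factorial with hK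
  have hKpos : 0 < K := by positivity
  have h : ∀ p, ‖x p‖ ^ 2 ≤ K * Real.pi ^ m * (star x ⬝ᵥ (matA z *ᵥ x)).re := fun p => by
    have h1 := sq_norm_le_expForm_of_eq_zero (fun q => z q - z p)
      (fun q => conj (translationFactor (z p) (z q)) * x q) hc p (by simp) fun q hq => hz q p hq
    rw [star_dotProduct_matA_mulVec z x (z p), Complex.re_ofReal_mul]
    simp only [translationFactor_self, map_one, one_mul] at h1
    refine h1.trans (le_of_eq ?_)
    rw [← hK]
    field_simp
  rcases isEmpty_or_nonempty V with hV | hV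
  · simp [dotProduct]
  have hv : (0 : ℝ) < Fintype.card V := by exact_mod_cast Fintype.card_pos
  have h2 := Finset.sum_le_sum fun p (_ : p ∈ Finset.univ) => h p
  rw [Finset.sum_const, Finset.card_univ, nsmul_eq_mul] at h2
  rw [gramBound, inv_mul_le_iff₀ (by positivity)]
  refine h2.trans (le_of_eq ?_)
  ring

lemma matA_eigenvalue_ge (z : V → EuclideanSpace ℂ (Fin m)) {c : ℝ} (hc : 0 < c)
    (hz : ∀ p q, p ≠ q → c ≤ ‖z p - z q‖) (p : V) :
    gramBound (Fintype.card V) m c ≤ (matA_isHermitian z).eigenvalues p := by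
  rw [IsHermitian.eigenvalues_eq]
  have h := gramBound_mul_le z ((matA_isHermitian z).eigenvectorBasis p).ofLp hc hz
  have h1 : ∑ q, ‖((matA_isHermitian z).eigenvectorBasis p).ofLp q‖ ^ 2 = 1 := by
    rw [← EuclideanSpace.norm_sq_eq, OrthonormalBasis.norm_eq_one, one_pow]
  rwa [h1, mul_one] at h

lemma matA_posDef (z : V → EuclideanSpace ℂ (Fin m)) {c : ℝ} (hc : 0 < c)
    (hz : ∀ p q, p ≠ q → c ≤ ‖z p - z q‖) : (matA z).PosDef := by
  rw [(matA_isHermitian z).posDef_iff_eigenvalues_pos]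
  exact fun p => (gramBound_pos (Fintype.card_pos_iff.2 ⟨p⟩).ne' m hc).trans_le
    (matA_eigenvalue_ge z hc hz p)

lemma gramBound_pow_le_norm_det (z : V → EuclideanSpace ℂ (Fin m)) {c : ℝ} (hc : 0 < c)
    (hz : ∀ p q, p ≠ q → c ≤ ‖z p - z q‖) :
    gramBound (Fintype.card V) m c ^ Fintype.card V ≤ ‖(matA z).det‖ := by
  rw [(matA_isHermitian z).det_eq_prod_eigenvalues, norm_prod, ← Finset.card_univ,
    ← Finset.prod_const, Finset.card_univ]
  refine Finset.prod_le_prod (fun p _ =>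
    (gramBound_pos (Fintype.card_pos_iff.2 ⟨p⟩).ne' m hc).le) fun p _ => ?_
  refine (matA_eigenvalue_ge z hc hz p).trans ?_
  simpa using le_abs_self _

end Szego

end ZeroCorrelation

namespace ZeroCorrelation

open Matrix Filter Topology
open scoped ComplexConjugate ComplexOrder

/-! ### Positivity of the conditional covariance, by difference quotients -/

variable {V : Type*} [Fintype V] {m : ℕ}

lemma posSemidef_expKernel (y : V → EuclideanSpace ℂ (Fin m)) (s : V → ℂ) :
    (of fun a b => 1 / (Real.pi : ℂ) ^ m *
      (s a * conj (s b) * Complex.exp (inner ℂ (y b) (y a)))).PosSemidef := by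
  refine .of_dotProduct_mulVec_nonneg ?_ fun x => ?_
  · ext a b
    simp only [conjTranspose_apply, of_apply, RCLike.star_def, map_mul, map_div₀, map_pow,
      Complex.conj_ofReal, Complex.conj_conj, ← Complex.exp_conj, inner_conj_symm, map_one]
    ring
  · have h : star x ⬝ᵥ ((of fun a b => 1 / (Real.pi : ℂ) ^ m *
        (s a * conj (s b) * Complex.exp (inner ℂ (y b) (y a)))) *ᵥ x) =
        ((1 / Real.pi ^ m : ℝ) : ℂ) * expForm y fun p => conj (s p) * x p := by
      simp only [dotProduct, mulVec, of_apply, Finset.mul_sum, expForm, Pi.star_apply]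
      refine Finset.sum_congr rfl fun p _ => Finset.sum_congr rfl fun p' _ => ?_
      simp only [map_mul, Complex.conj_conj]
      push_cast
      simp only [RCLike.star_def]
      ring
    rw [h]
    exact mul_nonneg (Complex.zero_le_real.2 (by positivity)) (expForm_nonneg _ _)

lemma posSemidef_of_tendsto {ι : Type*} [Fintype ι] {l : Filter ℝ} [l.NeBot]
    {M : ℝ → Matrix ι ι ℂ} {N : Matrix ι ι ℂ} (hM : ∀ᶠ ε in l, (M ε).PosSemidef)
    (h : ∀ a b, Tendsto (fun ε => M ε a b) l (𝓝 (N a b))) : N.PosSemidef := by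
  refine .of_dotProduct_mulVec_nonneg ?_ fun x => ?_
  · ext a b
    refine tendsto_nhds_unique (((h b a).star).congr' ?_) (h a b)
    filter_upwards [hM] with ε hε
    exact hε.1.apply a b
  · refine ge_of_tendsto (f := fun ε => star x ⬝ᵥ (M ε *ᵥ x)) (x := l) ?_ ?_
    · simp only [dotProduct, mulVec]
      exact tendsto_finsetSum _ fun a _ => (tendsto_finsetSum _ fun b _ =>
        (h a b).mul_const _).const_mul _
    · filter_upwards [hM] with ε hε
      exact hε.dotProduct_mulVec_nonneg x

section DifferenceQuotients

lemma tendsto_exp_slope (b : ℂ) :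
    Tendsto (fun ε : ℝ => (ε : ℂ)⁻¹ * (Complex.exp (ε * b) - 1)) (𝓝[≠] 0) (𝓝 b) := by
  have h : HasDerivAt (fun ε : ℝ => Complex.exp (ε * b)) b 0 := by
    have h1 : HasDerivAt (fun ε : ℝ => (ε : ℂ) * b) (1 * b) 0 :=
      (Complex.ofRealCLM.hasDerivAt).mul_const b
    have := h1.cexp
    simpa using this
  have := h.tendsto_slope_zero
  simpa using this

/-- The bracket equals exp(εb + εc)(exp(ε²d) - 1) + (exp(εb) - 1)(exp(εc) - 1). -/
lemma tendsto_exp_mixed_slope (b c d : ℂ) :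
    Tendsto (fun ε : ℝ => (ε : ℂ)⁻¹ * (ε : ℂ)⁻¹ * (Complex.exp (ε * b + ε * c + ε ^ 2 * d) -
      Complex.exp (ε * b) - Complex.exp (ε * c) + 1)) (𝓝[≠] 0) (𝓝 (d + b * c)) := by
  have hsq : Tendsto (fun ε : ℝ => ε ^ 2) (𝓝[≠] 0) (𝓝[≠] 0) := by
    refine tendsto_nhdsWithin_of_tendsto_nhds_of_eventually_within _ ?_ ?_
    · have : Tendsto (fun ε : ℝ => ε ^ 2) (𝓝 0) (𝓝 (0 ^ 2)) := (continuous_pow 2).tendsto 0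
      rw [zero_pow two_ne_zero] at this
      exact this.mono_left nhdsWithin_le_nhds
    · filter_upwards [self_mem_nhdsWithin] with ε hε
      exact pow_ne_zero 2 hε
  have h1 := (tendsto_exp_slope d).comp hsq
  have h2 : Tendsto (fun ε : ℝ => Complex.exp (ε * b + ε * c)) (𝓝[≠] 0) (𝓝 1) := by
    have : Continuous fun ε : ℝ => Complex.exp (ε * b + ε * c) := by fun_prop
    have h := this.tendsto 0
    simp only [Complex.ofReal_zero, zero_mul, add_zero, Complex.exp_zero] at h
    exact h.mono_left nhdsWithin_le_nhds
  have h3 := (h2.mul h1).add ((tendsto_exp_slope b).mul (tendsto_exp_slope c))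
  rw [one_mul] at h3
  refine h3.congr fun ε => ?_
  simp only [Function.comp_apply, Complex.ofReal_pow, Complex.exp_add, mul_comm]
  rw [← inv_pow]
  ring

end DifferenceQuotients

section JointCovariance

variable (z : V → EuclideanSpace ℂ (Fin m))

/-- The points `z^p` and their translates by `ε` in the coordinate directions. -/
noncomputable def shiftedPoints (ε : ℝ) : V ⊕ V × Fin m → EuclideanSpace ℂ (Fin m) :=
  Sum.elim z fun a => z a.1 + EuclideanSpace.single a.2 (ε : ℂ)

/-- The normalizing factors at the points `shiftedPoints z ε`. -/
noncomputable def shiftedFactors (ε : ℝ) : V ⊕ V × Fin m → ℂ :=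
  Sum.elim (fun p => Complex.exp (-(‖z p‖ : ℂ) ^ 2 / 2))
    -- The term linear in `ε` makes the covariance of the shifted value with the value at `z a.1`
    -- independent of `ε`. The difference quotients thus tend to covariant derivatives, with the
    -- covariances `matB` and `matC`.
    fun a => Complex.exp (-(‖z a.1‖ : ℂ) ^ 2 / 2 - ε * conj (z a.1 a.2))

/-- The covariance matrix of the values at the points `shiftedPoints z ε`. -/
noncomputable def shiftedCov (ε : ℝ) : Matrix (V ⊕ V × Fin m) (V ⊕ V × Fin m) ℂ :=
  of fun a b => 1 / (Real.pi : ℂ) ^ m * (shiftedFactors z ε a * conj (shiftedFactors z ε b) *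
    Complex.exp (inner ℂ (shiftedPoints z ε b) (shiftedPoints z ε a)))

omit [Fintype V] in
lemma shiftedCov_inl_inl (ε : ℝ) (p p' : V) :
    shiftedCov z ε (Sum.inl p) (Sum.inl p') = szegoKernel (z p) (z p') := by
  rw [shiftedCov, of_apply, szegoKernel_eq_inner]
  simp only [shiftedFactors, shiftedPoints, Sum.elim_inl, ← Complex.exp_conj, ← Complex.exp_add]
  congr 2
  simp only [map_neg, map_div₀, map_pow, Complex.conj_ofReal, map_ofNat]
  ring

omit [Fintype V] in
lemma shiftedCov_inl_inr (ε : ℝ) (p : V) (b : V × Fin m) :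
    shiftedCov z ε (Sum.inl p) (Sum.inr b) =
      szegoKernel (z p) (z b.1) * Complex.exp (ε * (z p b.2 - z b.1 b.2)) := by
  rw [shiftedCov, of_apply, szegoKernel_eq_inner]
  simp only [shiftedFactors, shiftedPoints, Sum.elim_inl, Sum.elim_inr, ← Complex.exp_conj,
    mul_assoc, ← Complex.exp_add]
  congr 2
  simp only [map_neg, map_sub, map_mul, map_div₀, map_pow, Complex.conj_ofReal, map_ofNat,
    Complex.conj_conj, inner_add_left, EuclideanSpace.inner_single_left]
  ring

omit [Fintype V] in
lemma shiftedCov_inr_inl (ε : ℝ) (a : V × Fin m) (p' : V) :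
    shiftedCov z ε (Sum.inr a) (Sum.inl p') =
      szegoKernel (z a.1) (z p') * Complex.exp (ε * (conj (z p' a.2) - conj (z a.1 a.2))) := by
  rw [shiftedCov, of_apply, szegoKernel_eq_inner]
  simp only [shiftedFactors, shiftedPoints, Sum.elim_inl, Sum.elim_inr, ← Complex.exp_conj,
    mul_assoc, ← Complex.exp_add]
  congr 2
  simp only [map_neg, map_div₀, map_pow, Complex.conj_ofReal, map_ofNat,
    inner_add_right, EuclideanSpace.inner_single_right]
  ring

omit [Fintype V] in
lemma shiftedCov_inr_inr (ε : ℝ) (a b : V × Fin m) :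
    shiftedCov z ε (Sum.inr a) (Sum.inr b) =
      szegoKernel (z a.1) (z b.1) * Complex.exp (ε * (conj (z b.1 a.2) - conj (z a.1 a.2)) +
        ε * (z a.1 b.2 - z b.1 b.2) + ε ^ 2 * if a.2 = b.2 then 1 else 0) := by
  rw [shiftedCov, of_apply, szegoKernel_eq_inner]
  simp only [shiftedFactors, shiftedPoints, Sum.elim_inr, ← Complex.exp_conj, mul_assoc,
    ← Complex.exp_add]
  congr 2
  have h : (EuclideanSpace.single b.2 (ε : ℂ) : EuclideanSpace ℂ (Fin m)) a.2 =
      if a.2 = b.2 then (ε : ℂ) else 0 := by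
    simp
  simp only [map_neg, map_sub, map_mul, map_div₀, map_pow, Complex.conj_ofReal, map_ofNat,
    Complex.conj_conj, inner_add_left, inner_add_right, EuclideanSpace.inner_single_left,
    EuclideanSpace.inner_single_right, h]
  split_ifs <;> simp <;> ring

variable [DecidableEq V]

/-- The incidence matrix of the derivatives with the points. -/
def incidence : Matrix (V × Fin m) V ℂ := of fun a p => if a.1 = p then 1 else 0

/-- The transition from the values at the points `shiftedPoints z ε` to the values at the points
`z p` and the difference quotients. -/
noncomputable def differenceMatrix (ε : ℝ) : Matrix (V ⊕ V × Fin m) (V ⊕ V × Fin m) ℂ :=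
  fromBlocks 1 0 (-(ε : ℂ)⁻¹ • incidence) ((ε : ℂ)⁻¹ • 1)

/-- The joint covariance matrix of the values and the derivatives is positive semidefinite. -/
theorem posSemidef_jointCov :
    (fromBlocks (matA z) (matB z) (matB z).conjTranspose (matC z)).PosSemidef := by
  refine posSemidef_of_tendsto (l := 𝓝[≠] 0)
    (M := fun ε => differenceMatrix ε * shiftedCov z ε * (differenceMatrix ε)ᴴ)
    (Eventually.of_forall fun ε => (posSemidef_expKernel _ _).mul_mul_conjTranspose_same _) ?_
  have hmul : ∀ ε : ℝ, differenceMatrix ε * shiftedCov z ε * (differenceMatrix ε)ᴴ =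
      fromBlocks (matA z)
        (of fun p b => (ε : ℂ)⁻¹ * (shiftedCov z ε (Sum.inl p) (Sum.inr b) -
          shiftedCov z ε (Sum.inl p) (Sum.inl b.1)))
        (of fun a p => (ε : ℂ)⁻¹ * (shiftedCov z ε (Sum.inr a) (Sum.inl p) -
          shiftedCov z ε (Sum.inl a.1) (Sum.inl p)))
        (of fun a b => (ε : ℂ)⁻¹ * (ε : ℂ)⁻¹ * (shiftedCov z ε (Sum.inr a) (Sum.inr b) -
          shiftedCov z ε (Sum.inr a) (Sum.inl b.1) - shiftedCov z ε (Sum.inl a.1) (Sum.inr b) +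
          shiftedCov z ε (Sum.inl a.1) (Sum.inl b.1))) := fun ε => by
    ext a b
    rcases a with a | a <;> rcases b with b | b <;>
      simp [Matrix.mul_apply, differenceMatrix, incidence, Fintype.sum_sum_type, Matrix.one_apply,
        matA, shiftedCov_inl_inl, apply_ite (starRingEnd ℂ)] <;> ring
  intro a b
  simp only [hmul]
  rcases a with p | a <;> rcases b with p' | b
  · exact tendsto_const_nhds
  · simp only [fromBlocks_apply₁₂, of_apply, shiftedCov_inl_inl, shiftedCov_inl_inr, matB]
    refine ((tendsto_exp_slope _).mul_const _).congr fun ε => ?_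
    ring
  · have hB : (matB z)ᴴ a p' =
        (conj (z p' a.2) - conj (z a.1 a.2)) * szegoKernel (z a.1) (z p') := by
      simp [matB, szegoKernel_conj]
    simp only [fromBlocks_apply₂₁, of_apply, shiftedCov_inl_inl, shiftedCov_inr_inl, hB]
    refine ((tendsto_exp_slope _).mul_const _).congr fun ε => ?_
    ring
  · simp only [fromBlocks_apply₂₂, of_apply, shiftedCov_inl_inl, shiftedCov_inr_inl,
      shiftedCov_inl_inr, shiftedCov_inr_inr, matC]
    refine ((tendsto_exp_mixed_slope _ _ _).mul_const _).congr fun ε => ?_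
    ring

/-- Λ is the Schur complement of the positive definite block A in the joint covariance. -/
lemma posSemidef_matLambda {c : ℝ} (hc : 0 < c) (hz : ∀ p q, p ≠ q → c ≤ ‖z p - z q‖) :
    (matLambda z).PosSemidef := by
  have hA := matA_posDef z hc hz
  have : Invertible (matA z) := hA.isUnit.invertible
  exact (PosDef.fromBlocks₁₁ (matB z) (matC z) hA).1 (posSemidef_jointCov z)

end JointCovariance

end ZeroCorrelation

namespace ZeroCorrelation

open MeasureTheory ProbabilityTheory Matrix Equiv
open scoped ComplexConjugate ComplexOrder Kronecker MatrixOrder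

/-! ### Moments of the standard complex Gaussian -/

section StdComplexGaussian

instance : IsProbabilityMeasure stdComplexGaussian :=
  Measure.isProbabilityMeasure_map (MeasurableEquiv.measurable _).aemeasurable

lemma stdComplexGaussian_eq :
    stdComplexGaussian = (volume.withDensity fun x : ℝ × ℝ =>
      ENNReal.ofReal (Real.pi⁻¹ * Real.exp (-(x.1 ^ 2 + x.2 ^ 2)))).map
        Complex.measurableEquivRealProd.symm := by
  have h : (1 / 2 : NNReal) ≠ 0 := by norm_num
  rw [stdComplexGaussian, gaussianReal_of_var_ne_zero _ h,
    prod_withDensity (measurable_gaussianPDF _ _) (measurable_gaussianPDF _ _),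
    Measure.volume_eq_prod]
  congr 2
  ext x
  rw [gaussianPDF, gaussianPDF, ← ENNReal.ofReal_mul (gaussianPDFReal_nonneg _ _ _)]
  congr 1
  simp only [gaussianPDFReal, sub_zero]
  rw [mul_mul_mul_comm, ← mul_inv, Real.mul_self_sqrt (by positivity), ← Real.exp_add]
  have h2 : (2 : ℝ) * ((1 / 2 : NNReal) : ℝ) = 1 := by norm_num
  rw [mul_right_comm, h2]
  ring_nf

lemma integral_stdComplexGaussian (f : ℂ → ℂ) :
    ∫ z, f z ∂stdComplexGaussian = ∫ z : ℂ, (Real.pi⁻¹ * Real.exp (-‖z‖ ^ 2)) • f z := by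
  rw [stdComplexGaussian_eq, integral_map_equiv, integral_withDensity_eq_integral_toReal_smul
    (by fun_prop) (by simp)]
  rw [← Complex.volume_preserving_equiv_real_prod.symm.integral_comp
    (MeasurableEquiv.measurableEmbedding _)]
  refine integral_congr_ae (.of_forall fun x => ?_)
  have h : ‖Complex.measurableEquivRealProd.symm x‖ ^ 2 = x.1 ^ 2 + x.2 ^ 2 := by
    rw [← Complex.normSq_eq_norm_sq, Complex.normSq_apply]
    simp [Complex.measurableEquivRealProd]
    ring
  simp only [h]
  rw [ENNReal.toReal_ofReal (by positivity)]

lemma integral_norm_pow_stdComplexGaussian (n : ℕ) :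
    ∫ z, ((‖z‖ ^ (2 * n) : ℝ) : ℂ) ∂stdComplexGaussian = (n.factorial : ℂ) := by
  have h := Complex.integral_rpow_mul_exp_neg_rpow (p := 2) (q := (2 * n : ℕ)) (by norm_num)
    (by have : (0 : ℝ) ≤ (2 * n : ℕ) := by positivity
        linarith)
  have h1 : ((2 * n : ℕ) + 2 : ℝ) / 2 = n + 1 := by push_cast; ring
  rw [h1, Real.Gamma_nat_eq_factorial] at h
  have h2 : ∀ z : ℂ, (Real.pi⁻¹ * Real.exp (-‖z‖ ^ 2)) • ((‖z‖ ^ (2 * n) : ℝ) : ℂ) =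
      ((Real.pi⁻¹ * (‖z‖ ^ ((2 * n : ℕ) : ℝ) * Real.exp (-‖z‖ ^ (2 : ℝ))) : ℝ) : ℂ) := fun z => by
    rw [Real.rpow_natCast, Real.rpow_two, Complex.real_smul]
    push_cast
    ring
  rw [integral_stdComplexGaussian]
  simp only [h2]
  rw [integral_complex_ofReal, integral_const_mul, h]
  push_cast
  field_simp

lemma integrable_pow_mul_conj_pow (a b : ℕ) :
    Integrable (fun z : ℂ => z ^ a * conj z ^ b) stdComplexGaussian := by
  have h : ∀ n : ℕ, Integrable (fun z : ℂ => ((‖z‖ ^ (2 * n) : ℝ) : ℂ)) stdComplexGaussian :=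
    fun n => by
      -- A function that is not integrable has integral `0` by convention, whereas this moment is
      -- `n!`.
      by_contra hn
      have h1 := integral_norm_pow_stdComplexGaussian n
      rw [integral_undef hn] at h1
      exact (Nat.cast_ne_zero.2 n.factorial_ne_zero) h1.symm
  refine ((h a).add (h b)).mono (by fun_prop) (.of_forall fun z => ?_)
  have h3 : ‖((‖z‖ ^ (2 * a) : ℝ) : ℂ) + ((‖z‖ ^ (2 * b) : ℝ) : ℂ)‖ =
      ‖z‖ ^ (2 * a) + ‖z‖ ^ (2 * b) := by
    rw [← Complex.ofReal_add, Complex.norm_real, Real.norm_of_nonneg (by positivity)]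
  rw [Pi.add_apply, h3, norm_mul, norm_pow, norm_pow, RCLike.norm_conj, pow_mul', pow_mul']
  nlinarith [sq_nonneg (‖z‖ ^ a - ‖z‖ ^ b), sq_nonneg (‖z‖ ^ a), sq_nonneg (‖z‖ ^ b)]

lemma integral_pow_mul_conj_pow (a b : ℕ) :
    ∫ z : ℂ, z ^ a * conj z ^ b ∂stdComplexGaussian = if a = b then (a.factorial : ℂ) else 0 := by
  split_ifs with hab
  · subst hab
    rw [← integral_norm_pow_stdComplexGaussian]
    congr 1
    ext z
    rw [← mul_pow, Complex.mul_conj', pow_mul]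
    push_cast
    rfl
  · rw [integral_stdComplexGaussian]
    set F : ℂ → ℂ := fun z => (Real.pi⁻¹ * Real.exp (-‖z‖ ^ 2)) • (z ^ a * conj z ^ b) with hF
    have hne : (a : ℂ) - b ≠ 0 := sub_ne_zero.2 (by exact_mod_cast hab)
    -- Rotation by the angle π/(a - b) preserves the measure and changes the sign of the integrand.
    set u : Circle := Circle.exp (Real.pi / ((a : ℝ) - b)) with hu
    have hu1 : (u : ℂ) ^ a * conj (u : ℂ) ^ b = -1 := by
      rw [hu, Circle.coe_exp, ← Complex.exp_conj, ← Complex.exp_nat_mul, ← Complex.exp_nat_mul,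
        ← Complex.exp_add, ← Complex.exp_pi_mul_I]
      congr 1
      simp only [map_mul, Complex.conj_ofReal, Complex.conj_I]
      push_cast
      field_simp
      ring
    have h1 : ∀ z, F (rotation u z) = -F z := fun z => by
      simp only [hF, rotation_apply, norm_mul, Circle.norm_coe, one_mul, map_mul, mul_pow]
      rw [mul_mul_mul_comm, hu1, neg_one_mul, smul_neg]
    have h2 : ∫ z, F (rotation u z) = ∫ z, F z :=
      (rotation u).measurePreserving.integral_comp
        (rotation u).toHomeomorph.measurableEmbedding F
    simp only [h1, integral_neg] at h2
    exact self_eq_neg.1 h2.symm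

end StdComplexGaussian

/-! ### Wick's formula -/

section Wick

variable {I ι : Type*} [Fintype I] [DecidableEq I] [Fintype ι] [DecidableEq ι]

/-- The left side counts the permutations with `c = d ∘ σ`. If the fibers of `c` and `d` match in
size, these form a coset of the stabilizer of `c`, whose order is the product of the factorials;
otherwise there are none. The right side is the product of the moments of the coordinates. -/
lemma sum_perm_prod_eq (c d : I → ι) :
    ∑ σ : Perm I, ∏ i, (if c i = d (σ i) then (1 : ℂ) else 0) =
      ∏ x, if Fintype.card {i // c i = x} = Fintype.card {i // d i = x} then
        ((Fintype.card {i // c i = x}).factorial : ℂ) else 0 := by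
  have h1 : ∀ σ : Perm I, (∏ i, (if c i = d (σ i) then (1 : ℂ) else 0)) =
      if c = d ∘ σ then 1 else 0 := fun σ => by
    rw [Finset.prod_ite_zero, Finset.prod_const_one]
    simp [funext_iff]
  simp only [h1]
  by_cases h : ∀ x, Fintype.card {i // c i = x} = Fintype.card {i // d i = x}
  · simp only [h, if_true]
    let σ₀ : Perm I := (Equiv.sigmaFiberEquiv c).symm.trans
      ((Equiv.sigmaCongrRight fun x => Fintype.equivOfCardEq (h x)).trans
        (Equiv.sigmaFiberEquiv d))
    have hσ₀ : d ∘ σ₀ = c := by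
      ext i
      exact (Fintype.equivOfCardEq (h (c i)) ⟨i, rfl⟩).2
    have h2 : ∑ σ : Perm I, (if c = d ∘ σ then (1 : ℂ) else 0) =
        ∑ σ : Perm I, if c ∘ σ = c then (1 : ℂ) else 0 := by
      rw [← Equiv.sum_comp (Equiv.mulLeft σ₀)]
      refine Finset.sum_congr rfl fun σ _ => ?_
      have : d ∘ (σ₀ * σ) = c ∘ σ := by rw [← hσ₀]; rfl
      simp only [Equiv.coe_mulLeft, this, eq_comm]
    rw [h2, Finset.sum_boole, ← Fintype.card_subtype, DomMulAct.stabilizer_card]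
    push_cast
    simp only [h]
  · have hx := h
    push Not at hx
    obtain ⟨x, hx⟩ := hx
    rw [Finset.prod_eq_zero (Finset.mem_univ x) (if_neg hx)]
    refine Finset.sum_eq_zero fun σ _ => if_neg ?_
    rintro rfl
    exact hx (Fintype.card_congr (σ.subtypeEquiv fun i => Iff.rfl))

omit [Fintype I] [DecidableEq I] [Fintype ι] in
lemma prod_comp_eq_prod_pow [Fintype I] [Fintype ι] (c : I → ι) (g : ι → ℂ) :
    ∏ i, g (c i) = ∏ x, g x ^ Fintype.card {i // c i = x} := by
  rw [← Finset.prod_fiberwise Finset.univ c]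
  refine Finset.prod_congr rfl fun x _ => ?_
  rw [Fintype.card_subtype, ← Finset.prod_const]
  refine Finset.prod_congr rfl fun i hi => ?_
  rw [(Finset.mem_filter.1 hi).2]

omit [DecidableEq I] in
lemma prod_mul_conj_eq (c d : I → ι) (g : ι → ℂ) :
    (∏ i, g (c i)) * ∏ i, conj (g (d i)) =
      ∏ x, (g x ^ Fintype.card {i // c i = x} * conj (g x) ^ Fintype.card {i // d i = x}) := by
  rw [prod_comp_eq_prod_pow c g, prod_comp_eq_prod_pow d fun x => conj (g x),
    Finset.prod_mul_distrib]

omit [DecidableEq I] in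
lemma integrable_prod_mul_conj (c d : I → ι) :
    Integrable (fun g : ι → ℂ => (∏ i, g (c i)) * ∏ i, conj (g (d i)))
      (Measure.pi fun _ => stdComplexGaussian) := by
  simp only [prod_mul_conj_eq]
  exact Integrable.fintype_prod
    (f := fun x z => z ^ Fintype.card {i // c i = x} * conj z ^ Fintype.card {i // d i = x})
    fun x => integrable_pow_mul_conj_pow _ _

lemma integral_prod_mul_conj (c d : I → ι) :
    ∫ g : ι → ℂ, (∏ i, g (c i)) * ∏ i, conj (g (d i))
      ∂(Measure.pi fun _ => stdComplexGaussian) =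
      ∑ σ : Perm I, ∏ i, (if c i = d (σ i) then (1 : ℂ) else 0) := by
  simp only [prod_mul_conj_eq]
  rw [integral_fintype_prod_eq_prod
    (f := fun x z => z ^ Fintype.card {i // c i = x} * conj z ^ Fintype.card {i // d i = x}),
    sum_perm_prod_eq]
  simp only [integral_pow_mul_conj_pow]

omit [DecidableEq ι] in
lemma prod_mulVec_mul_conj (T : Matrix ι ι ℂ) (a b : I → ι) (g : ι → ℂ) :
    (∏ i, (T *ᵥ g) (a i)) * ∏ i, conj ((T *ᵥ g) (b i)) =
      ∑ c : I → ι, ∑ d : I → ι, (∏ i, T (a i) (c i)) * (∏ i, conj (T (b i) (d i))) *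
        ((∏ i, g (c i)) * ∏ i, conj (g (d i))) := by
  simp only [mulVec, dotProduct, map_sum, map_mul, Finset.prod_univ_sum, Fintype.piFinset_univ]
  rw [Finset.sum_mul_sum]
  refine Finset.sum_congr rfl fun c _ => Finset.sum_congr rfl fun d _ => ?_
  rw [Finset.prod_mul_distrib, Finset.prod_mul_distrib, mul_mul_mul_comm]

/-- For fixed `σ` the constraint `c = d ∘ σ` removes the sum over `c`, and the sum over `d` factors
into entries of `T * Tᴴ`. -/
lemma sum_wick_eq (T : Matrix ι ι ℂ) (a b : I → ι) :
    ∑ c : I → ι, ∑ d : I → ι, (∏ i, T (a i) (c i)) * (∏ i, conj (T (b i) (d i))) *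
        ∑ σ : Perm I, ∏ i, (if c i = d (σ i) then (1 : ℂ) else 0) =
      (of fun i j => (T * Tᴴ) (a i) (b j)).permanent := by
  rw [← permanent_transpose, permanent]
  simp only [Finset.mul_sum]
  rw [Finset.sum_comm' (t' := Finset.univ) (s' := fun _ => Finset.univ) (by simp)]
  have : ∀ d : I → ι, ∑ c : I → ι, ∑ σ : Perm I,
      (∏ i, T (a i) (c i)) * (∏ i, conj (T (b i) (d i))) *
        ∏ i, (if c i = d (σ i) then (1 : ℂ) else 0) =
      ∑ σ : Perm I, ∏ i, T (a i) ((d ∘ σ) i) * conj (T (b (σ i)) ((d ∘ σ) i)) := fun d => by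
    rw [Finset.sum_comm]
    refine Finset.sum_congr rfl fun σ _ => ?_
    have h1 : ∏ i, conj (T (b i) (d i)) = ∏ i, conj (T (b (σ i)) (d (σ i))) :=
      (Equiv.prod_comp σ fun i => conj (T (b i) (d i))).symm
    have h2 : ∏ i, T (a i) (d (σ i)) = ∑ c : I → ι, ∏ i, (T (a i) (c i) *
        if c i = d (σ i) then (1 : ℂ) else 0) := by
      have := Finset.prod_univ_sum (fun _ : I => (Finset.univ : Finset ι))
        fun i x => T (a i) x * if x = d (σ i) then (1 : ℂ) else 0
      rw [Fintype.piFinset_univ] at this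
      rw [← this]
      simp
    simp only [Function.comp_apply]
    rw [Finset.prod_mul_distrib, h2, Finset.sum_mul, ← h1]
    refine Finset.sum_congr rfl fun c _ => ?_
    rw [Finset.prod_mul_distrib]
    ring
  simp only [this]
  rw [Finset.sum_comm]
  refine Finset.sum_congr rfl fun σ _ => ?_
  rw [Fintype.sum_equiv (σ.symm.arrowCongr (Equiv.refl ι)) _
    (fun d => ∏ i, T (a i) (d i) * conj (T (b (σ i)) (d i))) fun d => by
      simp [Equiv.arrowCongr]]
  have := Finset.prod_univ_sum (fun _ : I => (Finset.univ : Finset ι))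
    fun i x => T (a i) x * conj (T (b (σ i)) x)
  rw [Fintype.piFinset_univ] at this
  rw [← this]
  simp [Matrix.mul_apply]

variable {S : Matrix ι ι ℂ}

omit [DecidableEq ι] in
lemma measurable_mulVec (T : Matrix ι ι ℂ) : Measurable fun g : ι → ℂ => T *ᵥ g :=
  (continuous_const.matrix_mulVec continuous_id).measurable

lemma integrable_complexGaussian (a b : I → ι) :
    Integrable (fun ξ : ι → ℂ => (∏ i, ξ (a i)) * ∏ i, conj (ξ (b i))) (complexGaussian S) := by
  rw [complexGaussian, integrable_map_measure (Continuous.aestronglyMeasurable (by fun_prop))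
    (measurable_mulVec _).aemeasurable]
  simp only [Function.comp_def, prod_mulVec_mul_conj]
  exact integrable_finsetSum _ fun c _ => integrable_finsetSum _ fun d _ =>
    (integrable_prod_mul_conj c d).const_mul _

/-- Wick's formula for complex Gaussian measures. -/
theorem integral_complexGaussian (hS : S.PosSemidef) (a b : I → ι) :
    ∫ ξ : ι → ℂ, (∏ i, ξ (a i)) * ∏ i, conj (ξ (b i)) ∂(complexGaussian S) =
      (of fun i j => S (a i) (b j)).permanent := by
  have hsq : CFC.sqrt S * (CFC.sqrt S)ᴴ = S := by
    have h1 : (CFC.sqrt S).IsHermitian := (nonneg_iff_posSemidef.1 (CFC.sqrt_nonneg S)).1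
    rw [h1.eq]
    exact CFC.sqrt_mul_sqrt_self S (nonneg_iff_posSemidef.2 hS)
  rw [complexGaussian, integral_map (measurable_mulVec _).aemeasurable
    (Continuous.aestronglyMeasurable (by fun_prop))]
  simp only [prod_mulVec_mul_conj]
  rw [integral_finsetSum _ fun c _ => integrable_finsetSum _ fun d _ =>
    (integrable_prod_mul_conj c d).const_mul _]
  conv_rhs => rw [← hsq]
  rw [← sum_wick_eq]
  refine Finset.sum_congr rfl fun c _ => ?_
  rw [integral_finsetSum _ fun d _ => (integrable_prod_mul_conj c d).const_mul _]
  refine Finset.sum_congr rfl fun d _ => ?_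
  rw [integral_const_mul, integral_prod_mul_conj]

end Wick

/-! ### The Gaussian integral of the product of determinants -/

section DetProduct

variable {V : Type*} [Fintype V] [DecidableEq V] {m k : ℕ}

lemma prod_det_eq (ξ : Fin k × V × Fin m → ℂ) :
    ∏ p : V, (of fun j j' : Fin k => ∑ q, ξ (j, p, q) * conj (ξ (j', p, q))).det =
      ∑ τ : V → Perm (Fin k), ∑ q : V × Fin k → Fin m, (∏ p, ((Perm.sign (τ p) : ℤ) : ℂ)) *
        ((∏ x, ξ (τ x.1 x.2, x.1, q x)) * ∏ x, conj (ξ (x.2, x.1, q x))) := by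
  simp only [det_apply', Finset.prod_univ_sum, Fintype.piFinset_univ]
  refine Finset.sum_congr rfl fun τ _ => ?_
  rw [Finset.prod_mul_distrib, ← Finset.mul_sum]
  congr 1
  rw [← Fintype.prod_prod_type' (f := fun p j => (of fun j j' : Fin k =>
    ∑ q, ξ (j, p, q) * conj (ξ (j', p, q))) (τ p j) j)]
  simp only [of_apply, Finset.prod_univ_sum, Fintype.piFinset_univ, Finset.prod_mul_distrib]

/-- The identity factor of the covariance pairs only variables with the same section index, which is
the condition in `wickMatrix`. -/
lemma integral_prod_det {Λ : Matrix (V × Fin m) (V × Fin m) ℂ} (hΛ : Λ.PosSemidef) :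
    ∫ ξ : Fin k × V × Fin m → ℂ,
      ∏ p : V, (of fun j j' : Fin k => ∑ q, ξ (j, p, q) * conj (ξ (j', p, q))).det
      ∂(complexGaussian ((1 : Matrix (Fin k) (Fin k) ℂ) ⊗ₖ Λ)) = wickSum k Λ := by
  have hS : ((1 : Matrix (Fin k) (Fin k) ℂ) ⊗ₖ Λ).PosSemidef := PosSemidef.one.kronecker hΛ
  simp only [prod_det_eq]
  have hint : ∀ (τ : V → Perm (Fin k)) (q : V × Fin k → Fin m),
      Integrable (fun ξ : Fin k × V × Fin m → ℂ => (∏ p, ((Perm.sign (τ p) : ℤ) : ℂ)) *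
        ((∏ x, ξ (τ x.1 x.2, x.1, q x)) * ∏ x, conj (ξ (x.2, x.1, q x))))
        (complexGaussian ((1 : Matrix (Fin k) (Fin k) ℂ) ⊗ₖ Λ)) := fun τ q =>
    (integrable_complexGaussian (fun x : V × Fin k => (τ x.1 x.2, x.1, q x))
      fun x => (x.2, x.1, q x)).const_mul _
  rw [integral_finsetSum _ fun τ _ => integrable_finsetSum _ fun q _ => hint τ q, wickSum]
  refine Finset.sum_congr rfl fun τ _ => ?_
  rw [integral_finsetSum _ fun q _ => hint τ q]
  refine Finset.sum_congr rfl fun q _ => ?_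
  rw [integral_const_mul, integral_complexGaussian hS
    (fun x : V × Fin k => (τ x.1 x.2, x.1, q x)) fun x => (x.2, x.1, q x)]
  congr 2
  ext x y
  simp [wickMatrix, Matrix.one_apply]

end DetProduct

end ZeroCorrelation

namespace ZeroCorrelation

open MeasureTheory ProbabilityTheory Matrix
open scoped ComplexConjugate ComplexOrder

/-! ### The joint covariance of a configuration, and the conclusion -/

section JointMatrix

variable {V : Type*} {m : ℕ}

/-- The entries of the joint covariance matrix of the values and derivatives, divided by the
Szegő kernel. -/
def jointFactor (z w : EuclideanSpace ℂ (Fin m)) : Option (Fin m) → Option (Fin m) → ℂ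
  | none, none => 1
  | none, some q' => z q' - w q'
  | some q, none => conj (w q) - conj (z q)
  | some q, some q' => (if q = q' then 1 else 0) + (conj (w q) - conj (z q)) * (z q' - w q')

/-- The joint covariance matrix of the values and derivatives at the points `z`. -/
noncomputable def jointMatrix (z : V → EuclideanSpace ℂ (Fin m)) :
    Matrix (V × Option (Fin m)) (V × Option (Fin m)) ℂ :=
  of fun a b => jointFactor (z a.1) (z b.1) a.2 b.2 * szegoKernel (z a.1) (z b.1)

lemma norm_szegoKernel (z w : EuclideanSpace ℂ (Fin m)) :
    ‖szegoKernel z w‖ = 1 / Real.pi ^ m * Real.exp (-‖z - w‖ ^ 2 / 2) := by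
  rw [szegoKernel, norm_mul, Complex.norm_exp, norm_div, norm_pow, Complex.norm_real, norm_one,
    Real.norm_of_nonneg Real.pi_pos.le]
  congr 2
  rw [Complex.sub_re, Complex.ofReal_re, Complex.re_mul_ofReal, Complex.I_re]
  ring

lemma szegoKernel_self (z : EuclideanSpace ℂ (Fin m)) :
    szegoKernel z z = 1 / (Real.pi : ℂ) ^ m := by
  rw [szegoKernel_eq_inner, inner_self_eq_norm_sq_to_K]
  simp only [Complex.coe_algebraMap]
  ring_nf
  simp

lemma norm_jointFactor_le (z w : EuclideanSpace ℂ (Fin m)) (a b : Option (Fin m)) :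
    ‖jointFactor z w a b‖ ≤ 1 + ‖z - w‖ ^ 2 := by
  have h1 : ∀ q, ‖z q - w q‖ ≤ ‖z - w‖ := fun q => PiLp.norm_apply_le (z - w) q
  have h2 : ∀ q, ‖conj (w q) - conj (z q)‖ ≤ ‖z - w‖ := fun q => by
    rw [← map_sub, RCLike.norm_conj, norm_sub_rev]
    exact h1 q
  have h0 := norm_nonneg (z - w)
  rcases a with _ | q <;> rcases b with _ | q'
  · simp only [jointFactor, norm_one]
    nlinarith
  · simp only [jointFactor]
    nlinarith [h1 q']
  · simp only [jointFactor]
    nlinarith [h2 q]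
  · simp only [jointFactor]
    refine (norm_add_le _ _).trans (add_le_add ?_ ?_)
    · split_ifs <;> simp
    · rw [norm_mul, sq]
      exact mul_le_mul (h2 q) (h1 q') (norm_nonneg _) h0

/-- The polynomial factor is at most 1 + |z - w|², and separation absorbs the 1 into |z - w|²/c². -/
lemma norm_jointMatrix_le (z : V → EuclideanSpace ℂ (Fin m)) {c : ℝ} (hc : 0 < c)
    (a b : V × Option (Fin m)) (h : c ≤ ‖z a.1 - z b.1‖) :
    ‖jointMatrix z a b‖ ≤ 1 / Real.pi ^ m * (1 / c ^ 2 + 1) *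
      (‖z a.1 - z b.1‖ ^ 2 * Real.exp (-‖z a.1 - z b.1‖ ^ 2 / 2)) := by
  rw [jointMatrix, of_apply, norm_mul, norm_szegoKernel]
  have h1 := norm_jointFactor_le (z a.1) (z b.1) a.2 b.2
  have h2 : 1 ≤ 1 / c ^ 2 * ‖z a.1 - z b.1‖ ^ 2 := by
    rw [one_div_mul_eq_div, one_le_div (by positivity)]
    exact pow_le_pow_left₀ hc.le h 2
  calc _ ≤ ((1 / c ^ 2 + 1) * ‖z a.1 - z b.1‖ ^ 2) *
        (1 / Real.pi ^ m * Real.exp (-‖z a.1 - z b.1‖ ^ 2 / 2)) :=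
        mul_le_mul_of_nonneg_right (by linarith) (by positivity)
    _ = _ := by ring

/-- At a single point the value and the derivatives are uncorrelated and have equal variance, which
justifies the scalar diagonal blocks of `genericMatrix`. -/
lemma jointMatrix_of_eq [DecidableEq V] (z : V → EuclideanSpace ℂ (Fin m))
    (a b : V × Option (Fin m)) (h : a.1 = b.1) :
    jointMatrix z a b = if a = b then 1 / (Real.pi : ℂ) ^ m else 0 := by
  obtain ⟨p, a⟩ := a
  obtain ⟨p', b⟩ := b
  obtain rfl : p = p' := h
  rw [jointMatrix, of_apply, szegoKernel_self]
  rcases a with _ | q <;> rcases b with _ | q' <;> simp [jointFactor]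

variable [Fintype V] [DecidableEq V] (z : V → EuclideanSpace ℂ (Fin m))

omit [Fintype V] [DecidableEq V] in
lemma valueBlock_jointMatrix : valueBlock (jointMatrix z) = matA z := by
  ext p q
  simp [valueBlock, jointMatrix, jointFactor, matA]

lemma condCov_jointMatrix : condCov (jointMatrix z) = matLambda z := by
  have hB : mixedBlock (jointMatrix z) = matB z := by
    ext p b
    simp [mixedBlock, jointMatrix, jointFactor, matB]
  have hB' : mixedBlock' (jointMatrix z) = (matB z)ᴴ := by
    ext a p
    simp [mixedBlock', jointMatrix, jointFactor, matB, szegoKernel_conj]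
  have hC : derivBlock (jointMatrix z) = matC z := by
    ext a b
    simp [derivBlock, jointMatrix, jointFactor, matC]
  rw [condCov, hB, hB', hC, valueBlock_jointMatrix, matLambda]

/-- The normalizing constant of a single point. -/
noncomputable def pointConstant (k m : ℕ) : ℂ := ((zeroDensity k m : ℂ) * (Real.pi : ℂ) ^ k)⁻¹

lemma normalizedCorrelation_eq (k : ℕ) {c : ℝ} (hc : 0 < c)
    (hz : ∀ p q, p ≠ q → c ≤ ‖z p - z q‖) :
    normalizedCorrelation k z = correlationOf (pointConstant k m) k (jointMatrix z) := by
  rw [normalizedCorrelation, limitCorrelation, integral_prod_det (posSemidef_matLambda z hc hz),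
    correlationOf, condCov_jointMatrix, valueBlock_jointMatrix, pointConstant, inv_pow, mul_pow,
    mul_pow, ← pow_mul, ← pow_mul, mul_inv, mul_comm k, one_div, mul_inv]
  ring

lemma connectedCorrelation_eq (k : ℕ) {c : ℝ} (hc : 0 < c)
    (hz : ∀ p q, p ≠ q → c ≤ ‖z p - z q‖) :
    connectedCorrelation k z = connectedOf (pointConstant k m) k (jointMatrix z) := by
  refine Finset.sum_congr rfl fun G _ => ?_
  congr 1
  refine Finset.prod_congr rfl fun B _ => ?_
  exact normalizedCorrelation_eq (fun p : B => z p) k hc fun p q hpq =>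
    hz p q fun h => hpq (Subtype.ext h)

/-- The values of the variables of the generic joint covariance matrix at the points `z`. -/
noncomputable def entryValue (e : EntryIndex V m) : ℂ :=
  -- Variables with both ends at the same point do not occur in `genericMatrix`. The value 0 is
  -- compatible with the weight 0 of a loop.
  if e.1.1 = e.2.1 then 0 else jointMatrix z e.1 e.2

omit [Fintype V] in
lemma map_genericMatrix :
    (genericMatrix V m (1 / (Real.pi : ℂ) ^ m)).map (MvPolynomial.eval (entryValue z)) =
      jointMatrix z := by
  ext a b
  rw [map_apply, genericMatrix, of_apply]
  by_cases h : a.1 = b.1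
  · rw [jointMatrix_of_eq z a b h, if_pos h]
    split_ifs <;> simp
  · simp [h, entryValue]

end JointMatrix

/-- The connected correlation functions of separated points are bounded by the maximal weight of
a connected oriented graph with zero boundary. -/
theorem exists_norm_connectedCorrelation_le (V : Type*) [Fintype V] [DecidableEq V] (k m : ℕ)
    {c : ℝ} (hc : 0 < c) :
    ∃ C : ℝ, ∀ z : V → EuclideanSpace ℂ (Fin m), (∀ p q, p ≠ q → c ≤ ‖z p - z q‖) →
      ‖connectedCorrelation k z‖ ≤ C * graphDecay z := by
  set α : ℂ := 1 / (Real.pi : ℂ) ^ m with hα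
  have hα0 : α ≠ 0 := one_div_ne_zero (pow_ne_zero _ (by exact_mod_cast Real.pi_ne_zero))
  set M : ℝ := 1 / Real.pi ^ m * (1 / c ^ 2 + 1) with hM
  obtain ⟨C₀, -, hC₀⟩ := exists_bound_of_gaugeInvariant
    (connectedNum (V := V) (m := m) α (pointConstant k m) k)
    (isWeightedHomogeneous_connectedNum _ _ _)
    (fun P _ h1 h2 => killVars_connectedNum α _ hα0 k P h1 h2) M (by positivity)
  set D : ℝ := ∏ S : Finset V, (gramBound (Fintype.card S) m c ^ Fintype.card S) ^
    (Fintype.card S * k + k) with hD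
  -- For empty `S` the bound itself is `0⁻¹ = 0`, but its zeroth power is 1, the determinant of the
  -- empty matrix.
  have hgram : ∀ S : Finset V, 0 < gramBound (Fintype.card S) m c ^ Fintype.card S := fun S => by
    rcases Nat.eq_zero_or_pos (Fintype.card S) with h | h
    · simp [h]
    · exact pow_pos (gramBound_pos h.ne' m hc) _
  have hD0 : 0 < D := Finset.prod_pos fun S _ => pow_pos (hgram S) _
  refine ⟨C₀ / D, fun z hz => ?_⟩
  have hdet : ∀ S, MvPolynomial.eval (entryValue z)
      (valueBlock (restrict (genericMatrix V m α) S)).det = (matA fun p : S => z p).det :=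
    fun S => by
      have h : restrict (jointMatrix z) S = jointMatrix fun p : S => z p := rfl
      rw [← valueBlock_jointMatrix, ← h, ← map_genericMatrix, RingHom.map_det]
      rfl
  have hle : ∀ S : Finset V, gramBound (Fintype.card S) m c ^ Fintype.card S ≤
      ‖(matA fun p : S => z p).det‖ := fun S =>
    gramBound_pow_le_norm_det _ hc fun p q hpq => hz p q fun h => hpq (Subtype.ext h)
  have hmap := map_connectedNum (MvPolynomial.eval (entryValue z)) α (pointConstant k m) k
    fun S => by
      rw [hdet S, ← norm_pos_iff]
      exact (hgram S).trans_le (hle S)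
  rw [map_genericMatrix, MvPolynomial.eval_C, ← connectedCorrelation_eq z k hc hz] at hmap
  simp only [hdet] at hmap
  have hbound := hC₀ z (entryValue z) fun e => by
    rw [entryValue]
    split_ifs with h
    · simp [h]
    · exact norm_jointMatrix_le z hc e.1 e.2 (hz _ _ h)
  rw [hmap, norm_mul, norm_prod] at hbound
  have hDle : D ≤ ∏ S : Finset V, ‖(matA fun p : S => z p).det ^ (Fintype.card S * k + k)‖ :=
    Finset.prod_le_prod (fun S _ => (pow_pos (hgram S) _).le) fun S _ => by
      rw [norm_pow]
      exact pow_le_pow_left₀ (hgram S).le (hle S) _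
  -- The numerator is the connected function times the determinants, whose product has norm at least
  -- `D`.
  rw [div_mul_eq_mul_div, le_div_iff₀ hD0]
  exact (mul_le_mul_of_nonneg_left hDle (norm_nonneg _)).trans hbound

end ZeroCorrelation

theorem theorem5p3 (n k m : ℕ) (hn : 1 ≤ n) (hk : 1 ≤ k) (hkm : k ≤ m) (c : ℝ) (hc : 0 < c) :
    ∃ C : ℝ, ∀ z : Fin n → EuclideanSpace ℂ (Fin m),
      (∀ p q, p ≠ q → c ≤ ‖z p - z q‖) →
        ‖ZeroCorrelation.connectedCorrelation k z‖ ≤ C * ZeroCorrelation.graphDecay z :=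
  ZeroCorrelation.exists_norm_connectedCorrelation_le (Fin n) k m hc
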